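/- Let $\mathfrak P=(P_n)_{n\ge 0}$ be a subfactor planar algebra with loop parameter $\delta$, and let $k\ge 0$. Let $V_k=\bigoplus_{n\ge 0}P_{n,k}$, where $P_{n,k}=P_{n+k}$ is drawn as boxes with $2n$ strings on the top, $k$ strings on the left, $k$ strings on the right, and the distinguished interval at the top left corner. For $x\in P_{n,k}$ let $x^*\in P_{n,k}$ be its adjoint (the mirror image in a vertical line), and extend $*$ to a conjugate-linear map on $V_k$. For $a\in P_{m,k}$ and $b\in P_{n,k}$ put $a$ to the left of $b$ and join the $k$ right strings of $a$ to the $k$ left strings of $b$. For $0\le i\le\min(2m,2n)$ let $a\cdot_i b\in P_{m+n-i,k}$ be the result of joining, in addition, the last $i$ top strings of $a$ to the first $i$ top strings of $b$ by nested strings. Define, extended (sesqui)linearly to $V_k$: * $Gr_k(\mathfrak P)$ is $V_k$ with the product $a\star b=\sum_{i=0}^{\min(2m,2n)}a\cdot_i b$, the involution $*$, and the inner product $\langle a,b\rangle$ which is $0$ if $m\ne n$, and if $m=n$ is $\delta^{-k}$ times the value of the closed diagram in which every boundary point of $a$ is joined to the corresponding boundary point of $b^*$. * $Hr_k(\mathfrak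 P)$ is $V_k$ with the product $a\bullet b=a\cdot_0 b$, the involution $*$, and the inner product $$\langle\langle a,b\rangle\rangle=\delta^{-k}\sum_D \langle D, a\bullet b^*\rangle_{\mathrm{cl}},$$ where $D$ runs over all loopless Temperley–Lieb diagrams on $2(m+n)$ boundary points, and $\langle D,c\rangle_{\mathrm{cl}}$ is the value of the closed diagram obtained from $c\in P_{m+n,k}$ by connecting its top strings by $D$ and its left strings to its right strings. In both cases the identity element is the element $1\in P_{0,k}$ given by $k$ horizontal strings. A Temperley–Lieb diagram from $2i$ bottom points to $2j$ top points is called epi if every top point is connected to a bottom point; it acts as a linear map $P_{i,k}\to P_{j,k}$ on the top strings. Let $X:V_k\to V_k$ be the linear map whose block $P_{i,k}\to P_{j,k}$ is the sum of all epi Temperley–Lieb diagrams from $2i$ to $2j$ points. Then for all $a,b\in V_k$ $$\langle\langle a,b\rangle\rangle=\langle X(a),X(b)\rangle ,$$ and $X$ is an isometric $*$-isomorphism from $Hr_k(\mathfrak P)$ onto $Gr_k(\mathfrak P)$: it is a linear bijection with $X(1)=1$, $X(a\bullet b)=X(a)\star X(b)$ and $X(a^*)=X(a)^*$ for all $a,b\in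 V_k$. -/

import Mathlib

universe u

/-! ### Planar tangles -/

/-- Planar tangles are drawn in the upper half plane, in general position with respect to the
height: the boundary of the output disc is a horizontal line at the top, its distinguished
interval is the one that contains the far left (and the far right), and the tangle is swept
from the bottom to the top.  A slice changes the current row of strings in one place, with
`j` strings to its left:
* `cup j` creates two neighbouring strings, joined at a minimum;
* `cap j` joins the strings number `j` and `j + 1` (counted from `0`) at a maximum;
* `box j x` creates an input disc labelled by `x : V s k`, from which `2 * k` strings go up; they
  are the boundary points of the disc in clockwise order, starting after the distinguished
  interval of the disc, which is at its bottom. -/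
inductive Slice (V : Bool → ℕ → Type u) : Type u
  | cup (j : ℕ) : Slice V
  | cap (j : ℕ) : Slice V
  | box (j : ℕ) {s : Bool} {k : ℕ} (x : V s k) : Slice V

namespace Slice

variable {V : Bool → ℕ → Type u}

/-- The number of strings to the left of the slice. -/
def pos : Slice V → ℕ
  | cup j => j
  | cap j => j
  | box j _ => j

/-- The number of strings that end in the slice. -/
def ins : Slice V → ℕ
  | cup _ => 0
  | cap _ => 2
  | box _ _ => 0

/-- The number of strings that start in the slice. -/
def outs : Slice V → ℕ
  | cup _ => 2
  | cap _ => 0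
  | box (k := k) _ _ => 2 * k

/-- The slice moved to the right past `d` further strings. -/
def shift (d : ℕ) : Slice V → Slice V
  | cup j => cup (d + j)
  | cap j => cap (d + j)
  | box j x => box (d + j) x

end Slice

/-- `IsDiagram s n w m`: the slices `w` can be stacked, from the bottom to the top, on `n` strings
and leave `m` strings.  The regions between the strings are shaded alternately; `s` is the shade
of the leftmost region, so that `xor s j.bodd` is the shade of the region to the right of `j`
strings.  The label of a box has to belong to the shade of the distinguished region of the box. -/
def IsDiagram {V : Bool → ℕ → Type u} (s : Bool) : ℕ → List (Slice V) → ℕ → Prop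
  | n, [], m => n = m
  | n, Slice.cup j :: w, m => j ≤ n ∧ IsDiagram s (n + 2) w m
  | n, Slice.cap j :: w, m => j + 2 ≤ n ∧ IsDiagram s (n - 2) w m
  | n, Slice.box (s := t) (k := k) j _ :: w, m =>
      j ≤ n ∧ t = xor s j.bodd ∧ IsDiagram s (n + 2 * k) w m

/-- A planar tangle whose input discs are labelled by elements of the spaces `V t m`, and whose
output disc has `2 * k` boundary points and a distinguished interval of shade `s`. -/
structure Tangle (V : Bool → ℕ → Type u) (s : Bool) (k : ℕ) where
  word : List (Slice V)
  valid : IsDiagram s 0 word (2 * k)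

/-- `r` nested maxima, which join the strings `j, …, j + r - 1` with the strings
`j + r, …, j + 2 * r - 1`. -/
def nestedCaps {V : Bool → ℕ → Type u} (j : ℕ) : ℕ → List (Slice V)
  | 0 => []
  | r + 1 => Slice.cap (j + r) :: nestedCaps j r

/-- `r` nested minima, which create the strings `j, …, j + 2 * r - 1`. -/
def nestedCups {V : Bool → ℕ → Type u} : ℕ → ℕ → List (Slice V)
  | _, 0 => []
  | j, r + 1 => Slice.cup j :: nestedCups (j + 1) r

/-- The elementary planar isotopies: slices that are apart exchange heights, a zigzag of a
string is straightened, and a disc together with the ends of all its strings, which are bent over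
to one side of it, is turned to the other side (so that discs can be rotated). -/
inductive Move {V : Bool → ℕ → Type u} : List (Slice V) → List (Slice V) → Prop
  | exchange (A B : Slice V) (h : A.pos ≤ B.pos) :
      Move [A, B.shift A.outs] [B.shift A.ins, A]
  | zigzag_left (j : ℕ) : Move [Slice.cup j, Slice.cap (j + 1)] []
  | zigzag_right (j : ℕ) : Move [Slice.cup (j + 1), Slice.cap j] []
  | turn (j : ℕ) {t : Bool} {k : ℕ} (x : V t k) :
      Move (Slice.box j x :: nestedCaps j (2 * k)) (Slice.box (j + 2 * k) x :: nestedCaps j (2 * k))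

/-- The mirror image, in a vertical line, of a diagram that starts with `n` strings; labels are
replaced by their adjoints. -/
def reflectWord {V : Bool → ℕ → Type u} (adj : ∀ {s : Bool} {k : ℕ}, V s k → V s k) :
    ℕ → List (Slice V) → List (Slice V)
  | _, [] => []
  | n, Slice.cup j :: w => Slice.cup (n - j) :: reflectWord adj (n + 2) w
  | n, Slice.cap j :: w => Slice.cap (n - 2 - j) :: reflectWord adj (n - 2) w
  | n, Slice.box (k := k) j x :: w => Slice.box (n - j) (adj x) :: reflectWord adj (n + 2 * k) w

theorem isDiagram_append {V : Bool → ℕ → Type u} (s : Bool) (u v : List (Slice V)) (n l m : ℕ)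
    (hu : IsDiagram s n u l) (hv : IsDiagram s l v m) : IsDiagram s n (u ++ v) m := by
  induction u generalizing n with
  | nil => simp only [IsDiagram] at hu; subst hu; simpa using hv
  | cons a u ih =>
    cases a with
    | cup j => exact ⟨hu.1, ih _ hu.2⟩
    | cap j => exact ⟨hu.1, ih _ hu.2⟩
    | box j x => exact ⟨hu.1, hu.2.1, ih _ hu.2.2⟩

theorem isDiagram_nestedCaps {V : Bool → ℕ → Type u} (s : Bool) (j r n m : ℕ)
    (h : j + 2 * r ≤ n) (hm : m + 2 * r = n) :
    IsDiagram s n (nestedCaps (V := V) j r) m := by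
  induction r generalizing n with
  | zero => simp only [nestedCaps, IsDiagram]; omega
  | succ r ih => exact ⟨by omega, ih _ (by omega) (by omega)⟩

theorem isDiagram_nestedCups {V : Bool → ℕ → Type u} (s : Bool) (j r n m : ℕ)
    (h : j ≤ n) (hm : m = n + 2 * r) :
    IsDiagram s n (nestedCups (V := V) j r) m := by
  induction r generalizing n j with
  | zero => simp only [nestedCups, IsDiagram]; omega
  | succ r ih => exact ⟨h, ih _ _ (by omega) (by omega)⟩

theorem isDiagram_box {V : Bool → ℕ → Type u} (s : Bool) (j n m k : ℕ) (x : V s k)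
    (h : j ≤ n) (hj : Even j) (hm : m = n + 2 * k) : IsDiagram s n [Slice.box j x] m := by
  obtain ⟨i, rfl⟩ := hj
  exact ⟨h, by rw [Nat.bodd_add]; simp, by simp only [IsDiagram]; omega⟩

namespace Tangle

variable {V : Bool → ℕ → Type u}

/-- The tangle without discs and strings. -/
def empty (V : Bool → ℕ → Type u) (s : Bool) : Tangle V s 0 := ⟨[], rfl⟩

/-- The identity tangle: one disc, whose boundary points are joined to those of the output disc,
distinguished interval to distinguished interval. -/
def identity {s : Bool} {k : ℕ} (x : V s k) : Tangle V s k :=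
  ⟨[Slice.box 0 x], isDiagram_box s 0 0 _ k x le_rfl (by simp) (by omega)⟩

/-- A single closed string. -/
def loop (V : Bool → ℕ → Type u) (s : Bool) : Tangle V s 0 :=
  ⟨[Slice.cup 0, Slice.cap 0], by simp [IsDiagram]⟩

/-- The two strings of a disc joined to each other, with the distinguished region of the disc on
the outside. -/
def closeRight {s : Bool} (x : V s 1) : Tangle V s 0 :=
  ⟨[Slice.box 0 x, Slice.cap 0], by simp [IsDiagram]⟩

/-- The two strings of a disc joined to each other, with the distinguished region of the disc on
the inside. -/
def closeLeft {s : Bool} (x : V s 1) : Tangle V (!s) 0 :=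
  ⟨[Slice.cup 0, Slice.box 1 x, Slice.cap 0, Slice.cap 0], by simp [IsDiagram]⟩

/-- Two discs, whose boundary points are joined in opposite order. -/
def pair {s : Bool} {k : ℕ} (x y : V s k) : Tangle V s 0 :=
  ⟨[Slice.box 0 x] ++ [Slice.box (2 * k) y] ++ nestedCaps 0 (2 * k),
    isDiagram_append s _ _ 0 (2 * k + 2 * k) _
      (isDiagram_append s _ _ 0 (2 * k) _
        (isDiagram_box s 0 0 _ k x le_rfl (by simp) (by omega))
        (isDiagram_box s _ _ _ k y le_rfl (by simp) (by omega)))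
      (isDiagram_nestedCaps s _ _ _ _ (by omega) (by omega))⟩

end Tangle

/-! ### Planar algebras -/

/-- A (shaded) planar `*`-algebra over `ℂ`: spaces `V s n` (`s` is the shade of the distinguished
interval, `2 * n` the number of boundary points), and a multilinear action `Z` of planar tangles,
invariant under isotopy and compatible with the composition of tangles and with reflections. -/
structure PlanarStarAlgebra where
  V : Bool → ℕ → Type u
  [addCommGroup : ∀ s n, AddCommGroup (V s n)]
  [module : ∀ s n, Module ℂ (V s n)]
  /-- The action of labelled tangles. -/
  Z : ∀ {s : Bool} {n : ℕ}, Tangle V s n → V s n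
  Z_add : ∀ {s : Bool} {n : ℕ} (u v : List (Slice V)) (j : ℕ) {t : Bool} {m : ℕ} (x y : V t m)
    (T T₁ T₂ : Tangle V s n), T.word = u ++ Slice.box j (x + y) :: v →
    T₁.word = u ++ Slice.box j x :: v → T₂.word = u ++ Slice.box j y :: v →
    Z T = Z T₁ + Z T₂
  Z_smul : ∀ {s : Bool} {n : ℕ} (u v : List (Slice V)) (j : ℕ) {t : Bool} {m : ℕ} (c : ℂ)
    (x : V t m) (T T₁ : Tangle V s n), T.word = u ++ Slice.box j (c • x) :: v →
    T₁.word = u ++ Slice.box j x :: v → Z T = c • Z T₁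
  Z_isotopy : ∀ {s : Bool} {n : ℕ} (u v w w' : List (Slice V)) (T T' : Tangle V s n),
    Move w w' → T.word = u ++ w ++ v → T'.word = u ++ w' ++ v → Z T = Z T'
  Z_identity : ∀ {s : Bool} {n : ℕ} (x : V s n), Z (Tangle.identity x) = x
  /-- Composition: the tangle `R` may be glued into a disc that is labelled by its value. -/
  Z_comp : ∀ {s : Bool} {n : ℕ} (u v : List (Slice V)) (j : ℕ) {t : Bool} {m : ℕ}
    (R : Tangle V t m) (T T' : Tangle V s n), T.word = u ++ Slice.box j (Z R) :: v →
    T'.word = u ++ R.word.map (Slice.shift j) ++ v → Z T = Z T'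
  /-- The involution. -/
  adj : ∀ {s : Bool} {n : ℕ}, V s n → V s n
  adj_add : ∀ {s : Bool} {n : ℕ} (x y : V s n), adj (x + y) = adj x + adj y
  adj_smul : ∀ {s : Bool} {n : ℕ} (c : ℂ) (x : V s n), adj (c • x) = star c • adj x
  adj_adj : ∀ {s : Bool} {n : ℕ} (x : V s n), adj (adj x) = x
  Z_adj : ∀ {s : Bool} {n : ℕ} (T T' : Tangle V s n), T'.word = reflectWord adj 0 T.word →
    Z T' = adj (Z T)

attribute [instance] PlanarStarAlgebra.addCommGroup PlanarStarAlgebra.module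

open Classical in
/-- The scalar `c` for which `x : V s 0` is `c` times the value of the empty tangle. -/
noncomputable def PlanarStarAlgebra.scalar (P : PlanarStarAlgebra.{u}) {s : Bool} (x : P.V s 0) :
    ℂ :=
  if h : ∃ c : ℂ, x = c • P.Z (Tangle.empty P.V s) then h.choose else 0

/-- A subfactor planar algebra: a finite-dimensional planar `*`-algebra with one-dimensional
spaces `V s 0`, which is spherical, has a positive loop parameter `δ`, and on which the
canonical sesquilinear forms are positive definite. -/
structure SubfactorPlanarAlgebra extends PlanarStarAlgebra.{u} where
  finiteDimensional : ∀ s n, FiniteDimensional ℂ (V s n)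
  finrank_zero : ∀ s, Module.finrank ℂ (V s 0) = 1
  spherical : ∀ {s : Bool} (x : V s 1),
    toPlanarStarAlgebra.scalar (Z (Tangle.closeRight x)) =
      toPlanarStarAlgebra.scalar (Z (Tangle.closeLeft x))
  δ : ℝ
  δ_pos : 0 < δ
  Z_loop : ∀ s, Z (Tangle.loop V s) = (δ : ℂ) • Z (Tangle.empty V s)
  im_pair : ∀ {s : Bool} {n : ℕ} (x : V s n),
    (toPlanarStarAlgebra.scalar (Z (Tangle.pair x (adj x)))).im = 0
  re_pair_pos : ∀ {s : Bool} {n : ℕ} (x : V s n), x ≠ 0 →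
    0 < (toPlanarStarAlgebra.scalar (Z (Tangle.pair x (adj x)))).re

/-! ### Temperley–Lieb diagrams -/

/-- A Temperley–Lieb diagram without closed loops in a rectangle, with `N` points on the bottom
(`Sum.inl`) and `M` points on the top (`Sum.inr`), both numbered from left to right: a
noncrossing perfect matching of the boundary points. -/
@[ext]
structure TLDiagram (N M : ℕ) where
  partner : Fin N ⊕ Fin M → Fin N ⊕ Fin M
  partner_partner : ∀ p, partner (partner p) = p
  partner_ne : ∀ p, partner p ≠ p
  noncrossing : ∀ p q : Fin N ⊕ Fin M,
    let rank : Fin N ⊕ Fin M → ℕ := Sum.elim (fun i => (i : ℕ)) (fun j => N + (M - 1 - (j : ℕ)))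
    ¬ (rank p < rank q ∧ rank q < rank (partner p) ∧ rank (partner p) < rank (partner q))

namespace TLDiagram

variable {N M : ℕ}

noncomputable instance : Fintype (TLDiagram N M) :=
  Fintype.ofInjective partner fun _ _ h => TLDiagram.ext h

/-- Each point on the top is connected to the bottom. -/
def IsEpi (D : TLDiagram N M) : Prop := ∀ j : Fin M, ∃ i : Fin N, D.partner (Sum.inr j) = Sum.inl i

/-- Is the bottom point `b` the right end of a turn-back? -/
def isRightEnd (D : TLDiagram N M) (b : Fin N) : Bool :=
  match D.partner (Sum.inl b) with
  | Sum.inl a => decide (a < b)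
  | Sum.inr _ => false

/-- Turn-backs on a row of strings, the right ends of which are marked by `true`: the row is
read from the left to the right, `h` is the number of strings on the left that are still
open, and a right end is joined to the last of these. -/
def scan {V : Bool → ℕ → Type u} : ℕ → List Bool → List (Slice V)
  | _, [] => []
  | h, true :: l => Slice.cap (h - 1) :: scan (h - 1) l
  | h, false :: l => scan (h + 1) l

/-- An epi diagram, placed on the first `N` strings of a row, as a stack of slices. -/
def word {V : Bool → ℕ → Type u} (D : TLDiagram N M) : List (Slice V) :=
  scan 0 (List.ofFn D.isRightEnd)

theorem isDiagram_scan {V : Bool → ℕ → Type u} (s : Bool) (l : List Bool) (h R : ℕ)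
    (hl : ∀ p, p <+: l → 2 * p.count true ≤ h + p.length) :
    IsDiagram s (h + l.length + R) (scan (V := V) h l) (h + l.length + R - 2 * l.count true) := by
  induction l generalizing h with
  | nil => simp [scan, IsDiagram]
  | cons b l ih =>
    cases b with
    | true =>
      have h1 := hl [true] (by simp)
      simp at h1
      have key := ih (h - 1) (fun p hp => by
        have := hl (true :: p) (by simpa using hp)
        simp at this
        omega)
      refine ⟨by simp; omega, ?_⟩
      convert key using 1
      · simp; omega
      · simp; omega
    | false =>
      have key := ih (h + 1) (fun p hp => by
        have := hl (false :: p) (by simpa using hp)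
        simp at this
        omega)
      show IsDiagram s _ (scan (h + 1) l) _
      convert key using 1
      · simp; omega
      · simp; omega

theorem count_map_isRightEnd (D : TLDiagram N M) (L : List (Fin N)) (hL : L.Nodup) :
    (L.map D.isRightEnd).count true = (L.toFinset.filter fun b => D.isRightEnd b = true).card := by
  rw [List.count, List.countP_map, List.countP_eq_length_filter,
    ← List.toFinset_card_of_nodup (hL.filter _), List.toFinset_filter]
  congr 1
  ext b
  simp

theorem isRightEnd_iff (D : TLDiagram N M) (b : Fin N) :
    D.isRightEnd b = true ↔ ∃ a, a < b ∧ D.partner (Sum.inl b) = Sum.inl a := by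
  unfold isRightEnd
  rcases D.partner (Sum.inl b) with a | a <;> simp

theorem two_mul_count_le (D : TLDiagram N M) (p : List Bool)
    (hp : p <+: List.ofFn D.isRightEnd) : 2 * p.count true ≤ p.length := by
  classical
  obtain ⟨L, hL, rfl⟩ : ∃ L : List (Fin N), L <+: List.finRange N ∧ p = L.map D.isRightEnd := by
    rw [List.ofFn_eq_map] at hp
    refine ⟨(List.finRange N).take p.length, List.take_prefix _ _, ?_⟩
    rw [List.map_take]
    exact (List.prefix_iff_eq_take.mp hp)
  have hnd : L.Nodup := (List.nodup_finRange N).sublist hL.sublist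
  have hdown : ∀ b ∈ L, ∀ a : Fin N, a < b → a ∈ L := by
    intro b hb a hab
    have hLt := List.prefix_iff_eq_take.mp hL
    rw [hLt, List.mem_take_iff_getElem] at hb ⊢
    obtain ⟨i, hi, rfl⟩ := hb
    refine ⟨a, ?_, by simp⟩
    simp [Fin.lt_def] at hab hi ⊢
    omega
  rw [count_map_isRightEnd D L hnd, List.length_map, ← List.toFinset_card_of_nodup hnd,
    ← Finset.card_filter_add_card_filter_not (s := L.toFinset)
      (fun b => D.isRightEnd b = true), two_mul]
  refine Nat.add_le_add_left ?_ _
  refine Finset.card_le_card_of_injOn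
    (fun b => Sum.elim id (fun _ => b) (D.partner (Sum.inl b))) ?_ ?_
  · intro b hb
    simp only [Finset.coe_filter, Set.mem_ofPred_eq, List.mem_toFinset] at hb ⊢
    obtain ⟨a, hab, h⟩ := (D.isRightEnd_iff b).mp hb.2
    refine ⟨by simpa [h] using hdown b hb.1 a hab, ?_⟩
    simp only [h, Sum.elim_inl, id, isRightEnd_iff, not_exists, not_and]
    intro c hca hc
    have := D.partner_partner (Sum.inl b)
    rw [h, hc] at this
    have := Sum.inl.inj this
    subst this
    exact absurd hca (not_lt.mpr hab.le)
  · intro b hb b' hb' hbb'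
    simp only [Finset.coe_filter, Set.mem_ofPred_eq, List.mem_toFinset] at hb hb'
    obtain ⟨a, hab, h⟩ := (D.isRightEnd_iff b).mp hb.2
    obtain ⟨a', hab', h'⟩ := (D.isRightEnd_iff b').mp hb'.2
    simp only [h, h', Sum.elim_inl, id] at hbb'
    subst hbb'
    have := D.partner_partner (Sum.inl b)
    rw [h, ← h', D.partner_partner] at this
    exact (Sum.inl.inj this).symm

theorem two_mul_count_add (D : TLDiagram N M) (hD : D.IsEpi) :
    2 * (List.ofFn D.isRightEnd).count true + M = N := by
  classical
  have hinv : Function.Involutive D.partner := D.partner_partner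
  rw [List.ofFn_eq_map, count_map_isRightEnd D _ (List.nodup_finRange N)]
  set A := (List.finRange N).toFinset.filter fun b => D.isRightEnd b = true with hA
  choose t ht using hD
  have htinj : Function.Injective t := by
    intro i j hij
    have : D.partner (Sum.inr i) = D.partner (Sum.inr j) := by rw [ht, ht, hij]
    exact Sum.inr.inj (hinv.injective this)
  have hex : ∀ b : Fin N, ∃ a : Fin N, b ∈ A → a < b ∧ D.partner (Sum.inl b) = Sum.inl a := by
    intro b
    by_cases hb : b ∈ A
    · obtain ⟨a, ha⟩ := (D.isRightEnd_iff b).mp (Finset.mem_filter.mp hb).2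
      exact ⟨a, fun _ => ha⟩
    · exact ⟨b, fun h => absurd h hb⟩
  choose o ho using hex
  have hoinj : Set.InjOn o A := by
    intro b hb b' hb' h
    have : D.partner (Sum.inl b) = D.partner (Sum.inl b') := by rw [(ho b hb).2, (ho b' hb').2, h]
    exact Sum.inl.inj (hinv.injective this)
  have hpo : ∀ b ∈ A, D.partner (Sum.inl (o b)) = Sum.inl b := by
    intro b hb
    rw [← (ho b hb).2, D.partner_partner]
  have hpt : ∀ j, D.partner (Sum.inl (t j)) = Sum.inr j := by
    intro j
    rw [← ht, D.partner_partner]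
  have hcover : (Finset.univ : Finset (Fin N)) = A ∪ (A.image o ∪ Finset.univ.image t) := by
    symm
    rw [Finset.eq_univ_iff_forall]
    intro b
    rcases h : D.partner (Sum.inl b) with a | j
    · rcases lt_trichotomy a b with hab | hab | hab
      · refine Finset.mem_union_left _ ?_
        rw [hA, Finset.mem_filter]
        exact ⟨by simp, (D.isRightEnd_iff b).mpr ⟨a, hab, h⟩⟩
      · subst hab
        exact absurd h (D.partner_ne _)
      · refine Finset.mem_union_right _ (Finset.mem_union_left _ ?_)
        have h2 : D.partner (Sum.inl a) = Sum.inl b := by rw [← h, D.partner_partner]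
        have haA : a ∈ A := by
          rw [hA, Finset.mem_filter]
          exact ⟨by simp, (D.isRightEnd_iff a).mpr ⟨b, hab, h2⟩⟩
        refine Finset.mem_image.mpr ⟨a, haA, ?_⟩
        exact Sum.inl.inj ((ho a haA).2.symm.trans h2)
    · refine Finset.mem_union_right _ (Finset.mem_union_right _ ?_)
      refine Finset.mem_image.mpr ⟨j, Finset.mem_univ _, ?_⟩
      have : D.partner (Sum.inr j) = Sum.inl b := by rw [← h, D.partner_partner]
      exact Sum.inl.inj ((ht j).symm.trans this)
  have hd1 : Disjoint (A.image o) (Finset.univ.image t) := by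
    rw [Finset.disjoint_left]
    intro b hb hb'
    obtain ⟨c, hc, rfl⟩ := Finset.mem_image.mp hb
    obtain ⟨j, -, hj⟩ := Finset.mem_image.mp hb'
    have := hpo c hc
    rw [← hj, hpt] at this
    cases this
  have hd2 : Disjoint A (A.image o ∪ Finset.univ.image t) := by
    rw [Finset.disjoint_left]
    intro b hb hb'
    rcases Finset.mem_union.mp hb' with h | h
    · obtain ⟨c, hc, rfl⟩ := Finset.mem_image.mp h
      have h1 := (ho _ hb).2
      rw [hpo c hc] at h1
      have h2 := (ho _ hb).1
      rw [← Sum.inl.inj h1] at h2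
      exact absurd h2 (not_lt.mpr (ho c hc).1.le)
    · obtain ⟨j, -, rfl⟩ := Finset.mem_image.mp h
      have h1 := (ho _ hb).2
      rw [hpt] at h1
      cases h1
  have hcard := congrArg Finset.card hcover
  rw [Finset.card_union_of_disjoint hd2, Finset.card_union_of_disjoint hd1,
    Finset.card_image_of_injOn hoinj, Finset.card_image_of_injective _ htinj] at hcard
  simp at hcard
  omega

theorem isDiagram_word {V : Bool → ℕ → Type u} (s : Bool) (D : TLDiagram N M) (hD : D.IsEpi)
    (R : ℕ) : IsDiagram s (N + R) (D.word (V := V)) (M + R) := by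
  have h1 := isDiagram_scan (V := V) s (List.ofFn D.isRightEnd) 0 R
    (fun p hp => by simpa using D.two_mul_count_le p hp)
  have h2 := D.two_mul_count_add hD
  rw [List.length_ofFn, zero_add] at h1
  have h3 : N + R - 2 * (List.ofFn D.isRightEnd).count true = M + R := by omega
  rwa [h3] at h1

end TLDiagram

/-! ### The graded algebras

An element of `V true (n + k)`, seen as an element of degree `n`, is drawn as a box with `2 * n`
strings at the top, `k` strings on the right, `k` strings on the left, and the distinguished
interval at the top left corner; so its boundary points in clockwise order are the `2 * n` top
points from the left to the right, the `k` right points downwards, the `k` left points upwards. -/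

namespace Tangle

variable {V : Bool → ℕ → Type u}

/-- An epi diagram from `2 * i` to `2 * j` points, applied to the top strings of a box. -/
def applyTL {s : Bool} {i j : ℕ} (k : ℕ) (E : TLDiagram (2 * i) (2 * j)) (hE : E.IsEpi)
    (x : V s (i + k)) : Tangle V s (j + k) where
  word := [Slice.box 0 x] ++ E.word
  valid := isDiagram_append s _ _ 0 (2 * (i + k)) _
    (isDiagram_box s 0 0 _ _ x le_rfl (by simp) (by omega))
    (by simpa only [mul_add] using E.isDiagram_word s hE (2 * k))

/-- Multiplication: `x` on the left, `y` on the right; the last `i` strings at the top of `x` are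
joined to the first `i` strings at the top of `y`, and the strings on the right of `x` to those
on the left of `y`. The strings on the left of `y` are brought there by the nested minima, which
pass below `y`, and the nested maxima at `2 * m + 3 * k + 2 * n`. -/
def mul {s : Bool} {m n : ℕ} (k i : ℕ) (hi : i ≤ min (2 * m) (2 * n)) (x : V s (m + k))
    (y : V s (n + k)) : Tangle V s (m + n - i + k) where
  word := [Slice.box 0 x] ++ nestedCups (2 * m + k) k ++ [Slice.box (2 * m + 2 * k) y] ++
    nestedCaps (2 * m + 3 * k + 2 * n) k ++ nestedCaps (2 * m) k ++ nestedCaps (2 * m - i) i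
  valid :=
    isDiagram_append s _ _ 0 (2 * m + 2 * n + 2 * k) _
      (isDiagram_append s _ _ 0 (2 * m + 2 * n + 4 * k) _
        (isDiagram_append s _ _ 0 (2 * m + 2 * n + 6 * k) _
          (isDiagram_append s _ _ 0 (2 * m + 4 * k) _
            (isDiagram_append s _ _ 0 (2 * m + 2 * k) _
              (isDiagram_box s 0 0 _ _ x le_rfl (by simp) (by omega))
              (isDiagram_nestedCups s _ _ _ _ (by omega) (by omega)))
            (isDiagram_box s _ _ _ _ y (by omega) ⟨m + k, by omega⟩ (by omega)))
          (isDiagram_nestedCaps s _ _ _ _ (by omega) (by omega)))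
        (isDiagram_nestedCaps s _ _ _ _ (by omega) (by omega)))
      (isDiagram_nestedCaps s _ _ _ _ (by omega) (by omega))

/-- `k` parallel horizontal strings. -/
def one (V : Bool → ℕ → Type u) (s : Bool) (k : ℕ) : Tangle V s (0 + k) where
  word := nestedCups 0 k
  valid := isDiagram_nestedCups s _ _ _ _ le_rfl (by omega)

/-- The rotation that takes the last `2 * n` boundary points to the beginning: the nested minima
pass below the box. -/
def rotate {s : Bool} (n k : ℕ) (x : V s (n + k)) : Tangle V s (n + k) where
  word := nestedCups 0 (2 * n) ++ [Slice.box (2 * n) x] ++ nestedCaps (2 * n + 2 * k) (2 * n)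
  valid :=
    isDiagram_append s _ _ 0 (6 * n + 2 * k) _
      (isDiagram_append s _ _ 0 (4 * n) _
        (isDiagram_nestedCups s _ _ _ _ (by omega) (by omega))
        (isDiagram_box s _ _ _ _ x (by omega) (by simp) (by omega)))
      (isDiagram_nestedCaps s _ _ _ _ (by omega) (by omega))

/-- The diagram `D` on top of two boxes. Here `x` is a box of degree `m`, and `z`, on its right, is
the mirror image of a box of degree `n`: its boundary points are, clockwise, `k` right points
downwards, `k` left points upwards, `2 * n` top points, with the distinguished interval at the top
right corner. The left and right points of `x` are joined to the right and left points of `z`,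
respectively. -/
def pairTL {s : Bool} {m n : ℕ} (k : ℕ) (D : TLDiagram (2 * (m + n)) 0) (x : V s (m + k))
    (z : V s (n + k)) : Tangle V s 0 where
  word := [Slice.box 0 x] ++ [Slice.box (2 * (m + k)) z] ++ nestedCaps (2 * m) (2 * k) ++ D.word
  valid :=
    isDiagram_append s _ _ 0 (2 * (m + n)) _
      (isDiagram_append s _ _ 0 (2 * (m + n) + 4 * k) _
        (isDiagram_append s _ _ 0 (2 * (m + k)) _
          (isDiagram_box s 0 0 _ _ x le_rfl (by simp) (by omega))
          (isDiagram_box s _ _ _ _ z le_rfl (by simp) (by omega)))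
        (isDiagram_nestedCaps s _ _ _ _ (by omega) (by omega)))
      (by simpa using D.isDiagram_word s (fun j => j.elim0) 0)

end Tangle

namespace SubfactorPlanarAlgebra

variable (P : SubfactorPlanarAlgebra.{u}) (k : ℕ)

/-- The graded vector space on which both algebras live; its part of degree `n` is `V true (n + k)`,
where `true` is the unshaded side. -/
abbrev Gr : Type u := Π₀ n : ℕ, P.V true (n + k)

/-- An epi diagram as a linear map. -/
noncomputable def actTL {i j : ℕ} (E : TLDiagram (2 * i) (2 * j)) (hE : E.IsEpi) :
    P.V true (i + k) →ₗ[ℂ] P.V true (j + k) where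
  toFun x := P.Z (Tangle.applyTL k E hE x)
  map_add' x y := P.Z_add [] E.word 0 x y _ _ _ rfl rfl rfl
  map_smul' c x := P.Z_smul [] E.word 0 c x _ _ rfl rfl

open Classical in
/-- The change of basis: the sum of all epi Temperley–Lieb diagrams. -/
noncomputable def X : P.Gr k →ₗ[ℂ] P.Gr k :=
  DFinsupp.lsum ℂ fun i : ℕ => ∑ j ∈ Finset.range (i + 1),
    ∑ E : {E : TLDiagram (2 * i) (2 * j) // E.IsEpi},
      DFinsupp.lsingle (M := fun n : ℕ => P.V true (n + k)) j ∘ₗ P.actTL k E.1 E.2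

/-- The identity element, in degree `0`. -/
noncomputable def one : P.Gr k := DFinsupp.single 0 (P.Z (Tangle.one P.V true k))

/-- The involution: the mirror image in a vertical line, degree by degree. -/
noncomputable def dagger (a : P.Gr k) : P.Gr k :=
  open Classical in
  a.sum fun n x => DFinsupp.single n (P.Z (Tangle.rotate n k (P.adj x)))

/-- The juxtaposition product `a • b`. -/
noncomputable def bullet (a b : P.Gr k) : P.Gr k :=
  open Classical in
  a.sum fun m x => b.sum fun n y =>
    DFinsupp.single (m + n - 0) (P.Z (Tangle.mul k 0 (Nat.zero_le _) x y))

/-- The product `a ⋆ b`. -/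
noncomputable def starMul (a b : P.Gr k) : P.Gr k :=
  open Classical in
  a.sum fun m x => b.sum fun n y => ∑ i : Fin (min (2 * m) (2 * n) + 1),
    DFinsupp.single (m + n - (i : ℕ))
      (P.Z (Tangle.mul k (i : ℕ) (Nat.lt_succ_iff.mp i.isLt) x y))

/-- The orthogonal inner product `⟨a, b⟩`: the graded pieces are orthogonal, and the boundary
points of `a` are joined to the corresponding ones of the adjoint of `b`. -/
noncomputable def inner (a b : P.Gr k) : ℂ :=
  open Classical in
  a.sum fun n x => ((P.δ : ℂ) ^ k)⁻¹ * P.scalar (P.Z (Tangle.pair x (P.adj (b n))))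

/-- The inner product `⟨⟨a, b⟩⟩`: the sum over all loopless Temperley–Lieb diagrams on the top
strings of `a` and of the adjoint of `b`. -/
noncomputable def gjsInner (a b : P.Gr k) : ℂ :=
  open Classical in
  a.sum fun m x => b.sum fun n y => ∑ D : TLDiagram (2 * (m + n)) 0,
    ((P.δ : ℂ) ^ k)⁻¹ * P.scalar (P.Z (Tangle.pairTL k D x (P.adj y)))

end SubfactorPlanarAlgebra

/-! ### Words of slices -/

/-! Read the bottom points of an epi diagram from left to right: each point either opens a string or
closes the last open one, and the strings still open at the end are the through strings. So an epi
diagram amounts to a word of maxima, recorded together with the number of strings that remain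
(`capWords`), and `X` of a box is the sum of all these words placed on its top strings
(`sum_epi_eq_sum_capWords`, `X_single`).

The heart of the proof is `sum_capWords_split`. Up to exchange of heights, a word on new strings to
the right of `h` open ones consists of a word on the new strings alone, followed by some number `i`
of nested maxima between old and new strings. Hence an epi diagram on a juxtaposition is an epi
diagram on each factor together with a choice of `i`, and these data index the terms of the product
`⋆` of the two images under `X`. In the inner product of `Hr` no string may remain, so `i` must
exhaust the open strings of both factors; this is the pairing of `Gr`, with the second word seen in
a mirror.

The family of words is stable under reflection (`sum_capWords_reflect`). This removes the mirror in
the inner product. It also gives compatibility with `*`, once maxima have been slid through the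
rotation that is part of the involution (`eval_rotate_capWord`). Finally, the empty word acts as the
identity and every other word lowers the degree, so `X` is unitriangular and therefore bijective.

All isotopies are exchanges of heights (`Exch`), except that the rotation also needs a zigzag to be
straightened. -/

section Words

variable {V : Bool → ℕ → Type u}

namespace Slice

theorem shift_shift (d e : ℕ) (A : Slice V) : (A.shift e).shift d = A.shift (d + e) := by
  cases A <;> simp [shift, add_assoc]

@[simp] theorem shift_zero (A : Slice V) : A.shift 0 = A := by
  cases A <;> simp [shift]

@[simp] theorem pos_shift (d : ℕ) (A : Slice V) : (A.shift d).pos = d + A.pos := by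
  cases A <;> rfl

@[simp] theorem ins_shift (d : ℕ) (A : Slice V) : (A.shift d).ins = A.ins := by
  cases A <;> rfl

@[simp] theorem outs_shift (d : ℕ) (A : Slice V) : (A.shift d).outs = A.outs := by
  cases A <;> rfl

end Slice

/-- A word moved to the right past `d` further strings. -/
def shiftWord (d : ℕ) (w : List (Slice V)) : List (Slice V) := w.map (Slice.shift d)

@[simp] theorem shiftWord_nil (d : ℕ) : shiftWord d ([] : List (Slice V)) = [] := rfl

@[simp] theorem shiftWord_cons (d : ℕ) (A : Slice V) (w : List (Slice V)) :
    shiftWord d (A :: w) = A.shift d :: shiftWord d w := rfl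

@[simp] theorem shiftWord_append (d : ℕ) (w v : List (Slice V)) :
    shiftWord d (w ++ v) = shiftWord d w ++ shiftWord d v := List.map_append

@[simp] theorem shiftWord_zero (w : List (Slice V)) : shiftWord 0 w = w := by
  induction w <;> simp_all

theorem shiftWord_shiftWord (d e : ℕ) (w : List (Slice V)) :
    shiftWord d (shiftWord e w) = shiftWord (d + e) w := by
  induction w <;> simp_all [Slice.shift_shift]

theorem shiftWord_nestedCaps (d j r : ℕ) :
    shiftWord d (nestedCaps (V := V) j r) = nestedCaps (d + j) r := by
  induction r <;> simp_all [nestedCaps, Slice.shift, add_assoc]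

theorem shiftWord_nestedCups (d j r : ℕ) :
    shiftWord d (nestedCups (V := V) j r) = nestedCups (d + j) r := by
  induction r generalizing j <;> simp_all [nestedCups, Slice.shift, add_assoc]

theorem nestedCaps_add (j q r : ℕ) :
    nestedCaps (V := V) j (q + r) = nestedCaps (j + q) r ++ nestedCaps j q := by
  induction r with
  | zero => rfl
  | succ r ih => simp [nestedCaps, ← add_assoc, ih]

theorem nestedCups_add (j q r : ℕ) :
    nestedCups (V := V) j (q + r) = nestedCups j q ++ nestedCups (j + q) r := by
  induction q generalizing j with
  | zero => simp [nestedCups]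
  | succ q ih =>
    rw [Nat.succ_add]
    simp only [nestedCups, ih, List.cons_append, add_assoc, add_comm 1 q]

theorem isDiagram_append_iff (s : Bool) (u v : List (Slice V)) (n m : ℕ) :
    IsDiagram s n (u ++ v) m ↔ ∃ l, IsDiagram s n u l ∧ IsDiagram s l v m := by
  induction u generalizing n with
  | nil => simp [IsDiagram]
  | cons A u ih => cases A <;> simp [IsDiagram, ih, and_assoc]

theorem isDiagram_append_left_iff {s : Bool} {u : List (Slice V)} {n l : ℕ}
    (hu : IsDiagram s n u l) (v : List (Slice V)) (m : ℕ) :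
    IsDiagram s n (u ++ v) m ↔ IsDiagram s l v m := by
  induction u generalizing n with
  | nil => cases hu; rfl
  | cons A u ih =>
    cases A with
    | cup j => exact (and_iff_right hu.1).trans (ih hu.2)
    | cap j => exact (and_iff_right hu.1).trans (ih hu.2)
    | box j x =>
      exact (and_iff_right hu.1).trans ((and_iff_right hu.2.1).trans (ih hu.2.2))

/-- Every slice changes the number of strings by an even amount, so a box keeps its shade when it
passes another slice. An equivalence is needed because `eval` gives words that are not tangles the
value `0`, and this convention has to survive exchanges. -/
theorem isDiagram_exchange_iff (s : Bool) (n m : ℕ) (A B : Slice V) (h : A.pos ≤ B.pos)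
    (v : List (Slice V)) :
    IsDiagram s n (A :: B.shift A.outs :: v) m ↔ IsDiagram s n (B.shift A.ins :: A :: v) m := by
  cases A with
  | cup a =>
    cases B with
    | cup b =>
      simp only [Slice.pos] at h
      simp only [IsDiagram, Slice.shift, Slice.outs, Slice.ins]
      constructor <;> rintro ⟨h1, h2, h3⟩ <;> exact ⟨by omega, by omega, h3⟩
    | cap b =>
      simp only [Slice.pos] at h
      simp only [IsDiagram, Slice.shift, Slice.outs, Slice.ins]
      constructor <;> rintro ⟨h1, h2, h3⟩ <;>
        exact ⟨by omega, by omega, by convert h3 using 1; omega⟩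
    | box b x =>
      simp only [Slice.pos] at h
      simp only [IsDiagram, Slice.shift, Slice.outs, Slice.ins, Nat.bodd_add, zero_add]
      constructor
      · rintro ⟨h1, h2, h3, h4⟩
        exact ⟨by omega, by simpa using h3, by omega, by convert h4 using 1; omega⟩
      · rintro ⟨h1, h2, h3, h4⟩
        exact ⟨by omega, by omega, by simpa using h2, by convert h4 using 1; omega⟩
  | cap a =>
    cases B with
    | cup b =>
      simp only [Slice.pos] at h
      simp only [IsDiagram, Slice.shift, Slice.outs, Slice.ins]
      constructor <;> rintro ⟨h1, h2, h3⟩ <;>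
        exact ⟨by omega, by omega, by convert h3 using 1; omega⟩
    | cap b =>
      simp only [Slice.pos] at h
      simp only [IsDiagram, Slice.shift, Slice.outs, Slice.ins]
      constructor <;> rintro ⟨h1, h2, h3⟩ <;>
        exact ⟨by omega, by omega, by convert h3 using 1⟩
    | box b x =>
      simp only [Slice.pos] at h
      simp only [IsDiagram, Slice.shift, Slice.outs, Slice.ins, Nat.bodd_add, zero_add]
      constructor
      · rintro ⟨h1, h2, h3, h4⟩
        exact ⟨by omega, by simpa using h3, by omega, by convert h4 using 1; omega⟩
      · rintro ⟨h1, h2, h3, h4⟩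
        exact ⟨by omega, by omega, by simpa using h2, by convert h4 using 1; omega⟩
  | box a y =>
    cases B with
    | cup b =>
      simp only [Slice.pos] at h
      simp only [IsDiagram, Slice.shift, Slice.outs, Slice.ins, zero_add]
      constructor
      · rintro ⟨h1, h2, h3, h4⟩
        exact ⟨by omega, by omega, h2, by convert h4 using 1; omega⟩
      · rintro ⟨h1, h2, h3, h4⟩
        exact ⟨by omega, h3, by omega, by convert h4 using 1; omega⟩
    | cap b =>
      simp only [Slice.pos] at h
      simp only [IsDiagram, Slice.shift, Slice.outs, Slice.ins, zero_add]
      constructor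
      · rintro ⟨h1, h2, h3, h4⟩
        exact ⟨by omega, by omega, h2, by convert h4 using 1; omega⟩
      · rintro ⟨h1, h2, h3, h4⟩
        exact ⟨by omega, h3, by omega, by convert h4 using 1; omega⟩
    | box b x =>
      simp only [Slice.pos] at h
      simp only [IsDiagram, Slice.shift, Slice.outs, Slice.ins, Nat.bodd_add, zero_add]
      constructor
      · rintro ⟨h1, h2, h3, h4, h5⟩
        exact ⟨by omega, by simpa using h4, by omega, h2, by convert h5 using 1; omega⟩
      · rintro ⟨h1, h2, h3, h4, h5⟩
        exact ⟨by omega, h4, by omega, by simpa using h2, by convert h5 using 1; omega⟩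

/-- The `d` strings on the left and the `R` strings on the right are spectators; only those on the
left affect the shade, through their parity. -/
theorem isDiagram_shiftWord {s t : Bool} {n m : ℕ} {w : List (Slice V)} (hw : IsDiagram t n w m)
    (d R : ℕ) (ht : t = xor s d.bodd) :
    IsDiagram s (d + n + R) (shiftWord d w) (d + m + R) := by
  induction w generalizing n with
  | nil => cases hw; rfl
  | cons A w ih =>
    cases A with
    | cup j =>
      refine ⟨by have := hw.1; omega, ?_⟩
      have := ih hw.2
      convert this using 1
      · omega
      · rfl
    | cap j =>
      have h1 := hw.1
      refine ⟨by omega, ?_⟩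
      have := ih hw.2
      convert this using 1
      · omega
      · rfl
    | box j x =>
      obtain ⟨h1, h2, h3⟩ := hw
      refine ⟨by omega, ?_, ?_⟩
      · rw [h2, ht, Nat.bodd_add]; simp
      · have := ih h3
        convert this using 1
        · omega
        · rfl

/-! ### Exchange of heights -/

/-- Two words are equivalent under exchanges of the heights of slices. -/
inductive Exch : List (Slice V) → List (Slice V) → Prop
  | step (u v : List (Slice V)) (A B : Slice V) (h : A.pos ≤ B.pos) :
      Exch (u ++ A :: B.shift A.outs :: v) (u ++ B.shift A.ins :: A :: v)
  | refl (w : List (Slice V)) : Exch w w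
  | symm {w w' : List (Slice V)} : Exch w w' → Exch w' w
  | trans {w w' w'' : List (Slice V)} : Exch w w' → Exch w' w'' → Exch w w''

namespace Exch

theorem append_left {w w' : List (Slice V)} (h : Exch w w') (p : List (Slice V)) :
    Exch (p ++ w) (p ++ w') := by
  induction h with
  | step u v A B h => simpa using Exch.step (p ++ u) v A B h
  | refl w => exact refl _
  | symm _ ih => exact ih.symm
  | trans _ _ ih ih' => exact ih.trans ih'

theorem append_right {w w' : List (Slice V)} (h : Exch w w') (p : List (Slice V)) :
    Exch (w ++ p) (w' ++ p) := by
  induction h with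
  | step u v A B h => simpa using Exch.step u (v ++ p) A B h
  | refl w => exact refl _
  | symm _ ih => exact ih.symm
  | trans _ _ ih ih' => exact ih.trans ih'

theorem shiftWord {w w' : List (Slice V)} (h : Exch w w') (d : ℕ) :
    Exch (_root_.shiftWord d w) (_root_.shiftWord d w') := by
  induction h with
  | step u v A B h =>
    have := Exch.step (_root_.shiftWord d u) (_root_.shiftWord d v) (A.shift d) (B.shift d)
      (by simpa using h)
    simpa [Slice.shift_shift, add_comm] using this
  | refl w => exact refl _
  | symm _ ih => exact ih.symm
  | trans _ _ ih ih' => exact ih.trans ih'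

theorem interchange_slice {s : Bool} {n m : ℕ} {w : List (Slice V)} (hw : IsDiagram s n w m)
    (B : Slice V) : Exch (w ++ [B.shift m]) (B.shift n :: w) := by
  induction w generalizing n with
  | nil => cases hw; exact refl _
  | cons A w ih =>
    -- `l` counts the strings that bypass `A`. Since `A` sits among them, `B.shift l` lies to its
    -- right, and the exchange of the two is allowed.
    have key : ∃ l, IsDiagram s (l + A.outs) w m ∧ A.pos ≤ l ∧ l + A.ins = n := by
      cases A with
      | cup j => exact ⟨n, hw.2, hw.1, rfl⟩
      | cap j =>
        have := hw.1
        exact ⟨n - 2, hw.2, by simp only [Slice.pos]; omega, by simp only [Slice.ins]; omega⟩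
      | box j x => exact ⟨n, hw.2.2, hw.1, rfl⟩
    obtain ⟨l, h1, h2, rfl⟩ := key
    refine ((ih h1).append_left [A]).trans ?_
    have := Exch.step [] w A (B.shift l) (by rw [Slice.pos_shift]; omega)
    simpa [Slice.shift_shift, add_comm] using this

/-- A word and a word to its right exchange heights. -/
theorem interchange {s : Bool} {n m : ℕ} {w : List (Slice V)} (hw : IsDiagram s n w m)
    (v : List (Slice V)) :
    Exch (w ++ _root_.shiftWord m v) (_root_.shiftWord n v ++ w) := by
  induction v with
  | nil => simpa using refl w
  | cons B v ih =>
    have h1 := (interchange_slice hw B).append_right (_root_.shiftWord m v)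
    have h2 := ih.append_left [B.shift n]
    simpa using (show Exch (w ++ [B.shift m] ++ _root_.shiftWord m v) _ from h1).trans
      (by simpa using h2)

/-- Maxima put no condition on shades, so the shade `true` chosen in the proof is arbitrary. -/
theorem nestedCaps_comm (j r : ℕ) (v : List (Slice V)) :
    Exch (nestedCaps j r ++ _root_.shiftWord j v) (_root_.shiftWord (j + 2 * r) v ++ nestedCaps j r) :=
  interchange (isDiagram_nestedCaps true j r (j + 2 * r) j le_rfl rfl) v

theorem nestedCups_comm (j r : ℕ) (v : List (Slice V)) :
    Exch (nestedCups j r ++ _root_.shiftWord (j + 2 * r) v) (_root_.shiftWord j v ++ nestedCups j r) :=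
  interchange (isDiagram_nestedCups true j r j (j + 2 * r) le_rfl rfl) v

end Exch

/-! ### Sums over words of maxima -/

/-- The words that join neighbouring strings by maxima, read from the left to the right along `N`
strings to the right of `h` open strings; the second entry is the number of strings that remain. -/
def capWords (V : Bool → ℕ → Type u) (h : ℕ) : ℕ → Multiset (List (Slice V) × ℕ)
  | 0 => {([], h)}
  | N + 1 => (capWords V h N).bind fun c => (c.1, c.2 + 1) ::ₘ
      if 0 < c.2 then {(c.1 ++ [Slice.cap (c.2 - 1)], c.2 - 1)} else 0

section Sums

variable {M : Type*} [AddCommMonoid M]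

theorem sum_capWords_succ (h N : ℕ) (F : List (Slice V) × ℕ → M) :
    ((capWords V h (N + 1)).map F).sum = ((capWords V h N).map fun c => F (c.1, c.2 + 1) +
      if 0 < c.2 then F (c.1 ++ [Slice.cap (c.2 - 1)], c.2 - 1) else 0).sum := by
  rw [capWords, Multiset.map_bind, Multiset.sum_bind]
  congr 1
  refine Multiset.map_congr rfl fun c _ => ?_
  split_ifs <;> simp

/-- The reading may be interrupted after `a` strings and resumed with whatever is then open. This
separates the strings of the two factors of a product. -/
theorem sum_capWords_add (h a b : ℕ) (F : List (Slice V) × ℕ → M) :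
    ((capWords V h (a + b)).map F).sum = ((capWords V h a).map fun c =>
      ((capWords V c.2 b).map fun d => F (c.1 ++ d.1, d.2)).sum).sum := by
  induction b generalizing F with
  | zero => simp [capWords]
  | succ b ih =>
    rw [← add_assoc, sum_capWords_succ, ih]
    congr 1
    refine Multiset.map_congr rfl fun c _ => ?_
    rw [sum_capWords_succ]
    simp


theorem isDiagram_capWords {h N : ℕ} {c : List (Slice V) × ℕ} (hc : c ∈ capWords V h N)
    (s : Bool) : IsDiagram s (h + N) c.1 c.2 := by
  induction N generalizing c with
  | zero =>
    simp only [capWords, Multiset.mem_singleton] at hc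
    subst hc; rfl
  | succ N ih =>
    simp only [capWords, Multiset.mem_bind, Multiset.mem_cons] at hc
    obtain ⟨c', hc', rfl | hc⟩ := hc
    · simpa [add_assoc] using isDiagram_shiftWord (s := s) (ih hc') 0 1 (by simp)
    · split_ifs at hc with h0
      · rw [Multiset.mem_singleton] at hc
        subst hc
        have := isDiagram_shiftWord (s := s) (ih hc') 0 1 (by simp)
        simp only [shiftWord_zero, zero_add] at this
        exact isDiagram_append s _ _ _ _ _ this ⟨by omega, by simp only [IsDiagram]; omega⟩
      · simp at hc

theorem parity_capWords {h N : ℕ} {c : List (Slice V) × ℕ} (hc : c ∈ capWords V h N) :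
    c.2 + 2 * c.1.length = h + N := by
  induction N generalizing c with
  | zero =>
    simp only [capWords, Multiset.mem_singleton] at hc
    subst hc; rfl
  | succ N ih =>
    simp only [capWords, Multiset.mem_bind, Multiset.mem_cons] at hc
    obtain ⟨c', hc', rfl | hc⟩ := hc
    · have := ih hc'
      simp only; omega
    · have := ih hc'
      split_ifs at hc with h0
      · rw [Multiset.mem_singleton] at hc
        subst hc
        simp; omega
      · simp at hc

/-- The words of maxima to the right of `h` strings: those on the new strings alone, followed by
maxima that join new strings to old ones. -/
theorem sum_capWords_split (F : List (Slice V) → ℕ → M)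
    (hF : ∀ w w' t, Exch w w' → F w t = F w' t) (h N : ℕ) :
    ((capWords V h N).map fun c => F c.1 c.2).sum = ((capWords V 0 N).map fun c =>
      ∑ i ∈ Finset.range (min h c.2 + 1),
        F (shiftWord h c.1 ++ nestedCaps (h - i) i) (h + c.2 - 2 * i)).sum := by
  induction N generalizing F with
  | zero => simp [capWords, nestedCaps]
  | succ N ih =>
    rw [sum_capWords_succ, sum_capWords_succ]
    rw [ih (fun w t => F w (t + 1) + if 0 < t then F (w ++ [Slice.cap (t - 1)]) (t - 1) else 0)]
    · congr 1
      refine Multiset.map_congr rfl fun c _ => ?_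
      obtain ⟨w, t⟩ := c
      simp only
      rw [Finset.sum_add_distrib]
      -- As long as `i < t`, the last open string is a new one. A maximum on it is disjoint from the
      -- `i` nested maxima and can be moved below them, into the word on the new strings.
      have hcap : ∀ i, i < t → i ≤ h → F (shiftWord h w ++ nestedCaps (h - i) i ++
          [Slice.cap (h + t - 2 * i - 1)]) (h + t - 2 * i - 1) =
          F (shiftWord h (w ++ [Slice.cap (t - 1)]) ++ nestedCaps (h - i) i)
            (h + (t - 1) - 2 * i) := by
        intro i hi hih
        rw [show h + (t - 1) - 2 * i = h + t - 2 * i - 1 by omega]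
        apply hF
        have := (Exch.nestedCaps_comm (h - i) i [Slice.cap (V := V) (t - 1 - i)]).append_left
          (shiftWord h w)
        simp only [shiftWord_cons, Slice.shift, shiftWord_nil] at this
        rw [show h - i + (t - 1 - i) = h + t - 2 * i - 1 by omega,
          show h - i + 2 * i + (t - 1 - i) = h + (t - 1) by omega] at this
        simpa [Slice.shift] using this
      rcases lt_or_ge t h with hth | hth
      · -- new strings may all be joined to old ones
        rw [show min h t = t by omega, show min h (t + 1) = t + 1 by omega]
        rw [Finset.sum_range_succ (n := t + 1)]
        rw [add_assoc]
        congr 1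
        · refine Finset.sum_congr rfl fun i hi => ?_
          rw [Finset.mem_range] at hi
          congr 1; omega
        -- In the term `i = t` all new strings are used up, so the next string is joined to an old
        -- one; this lengthens the nest to `t + 1` maxima.
        · rw [Finset.sum_range_succ, add_comm]
          rw [if_pos (by omega)]
          congr 1
          · rw [show h + t - 2 * t - 1 = h - (t + 1) by omega,
              show h + (t + 1) - 2 * (t + 1) = h - (t + 1) by omega]
            congr 1
            rw [add_comm t 1, nestedCaps_add, show h - (1 + t) + 1 = h - t by omega]
            simp [nestedCaps, add_comm]
          · split_ifs with h0
            · rw [show min h (t - 1) + 1 = t by omega]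
              refine Finset.sum_congr rfl fun i hi => ?_
              rw [Finset.mem_range] at hi
              rw [if_pos (by omega)]
              exact hcap i hi (by omega)
            · rw [show t = 0 by omega]; simp
      · rw [show min h t = h by omega, show min h (t + 1) = h by omega]
        congr 1
        · refine Finset.sum_congr rfl fun i hi => ?_
          rw [Finset.mem_range] at hi
          congr 1; omega
        · split_ifs with h0
          -- If `t = h`, the term `i = h` leaves no open string for a further maximum and
          -- contributes nothing.
          · rcases eq_or_lt_of_le hth with rfl | hlt
            · rw [Finset.sum_range_succ, if_neg (by omega), add_zero,
                show min h (h - 1) + 1 = h by omega]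
              refine Finset.sum_congr rfl fun i hi => ?_
              rw [Finset.mem_range] at hi
              rw [if_pos (by omega)]
              exact hcap i hi (by omega)
            · rw [show min h (t - 1) + 1 = h + 1 by omega]
              refine Finset.sum_congr rfl fun i hi => ?_
              rw [Finset.mem_range] at hi
              rw [if_pos (by omega)]
              exact hcap i (by omega) (by omega)
          · refine Finset.sum_eq_zero fun i hi => ?_
            rw [if_neg (by omega)]
    · intro w w' t hw
      rw [hF _ _ _ hw, hF _ _ _ (hw.append_right _)]

/-! ### Reflection of words -/

theorem reflectWord_append (adj : ∀ {s : Bool} {k : ℕ}, V s k → V s k) {s : Bool} {n l : ℕ}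
    {u : List (Slice V)} (hu : IsDiagram s n u l) (v : List (Slice V)) :
    reflectWord adj n (u ++ v) = reflectWord adj n u ++ reflectWord adj l v := by
  induction u generalizing n with
  | nil => cases hu; rfl
  | cons A u ih =>
    cases A with
    | cup j => simp [reflectWord, ih hu.2]
    | cap j => simp [reflectWord, ih hu.2]
    | box j x => simp [reflectWord, ih hu.2.2]

/-- Further strings on the right of a word appear on the left of its mirror image. -/
theorem reflectWord_add (adj : ∀ {s : Bool} {k : ℕ}, V s k → V s k) {s : Bool} {n l : ℕ}
    {u : List (Slice V)} (hu : IsDiagram s n u l) (d : ℕ) :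
    reflectWord adj (d + n) u = shiftWord d (reflectWord adj n u) := by
  induction u generalizing n with
  | nil => rfl
  | cons A u ih =>
    cases A with
    | cup j =>
      have := hu.1
      simp [reflectWord, Slice.shift, ← ih hu.2, add_assoc]; omega
    | cap j =>
      have := hu.1
      simp only [reflectWord, Slice.shift, ← ih hu.2, shiftWord_cons]
      rw [show d + n - 2 - j = d + (n - 2 - j) by omega, show d + n - 2 = d + (n - 2) by omega]
    | box j x =>
      have := hu.1
      simp [reflectWord, Slice.shift, ← ih hu.2.2, add_assoc]; omega

/-- The mirror exchanges the leftmost and the rightmost region, and the shades of these differ by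
the parity of the number of strings. -/
theorem isDiagram_reflectWord (adj : ∀ {s : Bool} {k : ℕ}, V s k → V s k) {s : Bool} {n l : ℕ}
    {u : List (Slice V)} (hu : IsDiagram s n u l) :
    IsDiagram (xor s n.bodd) n (reflectWord adj n u) l := by
  induction u generalizing n with
  | nil => exact hu
  | cons A u ih =>
    cases A with
    | cup j =>
      refine ⟨by omega, ?_⟩
      have := ih hu.2
      simpa [Nat.bodd_add] using this
    | cap j =>
      have h1 := hu.1
      refine ⟨by omega, ?_⟩
      have := ih hu.2
      have h2 : (n - 2).bodd = n.bodd := by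
        conv_rhs => rw [show n = n - 2 + 2 by omega, Nat.bodd_add]
        simp
      rwa [h2] at this
    | box j x =>
      obtain ⟨h1, h2, h3⟩ := hu
      refine ⟨by omega, ?_, ?_⟩
      · have : n.bodd = xor (n - j).bodd j.bodd := by
          rw [← Nat.bodd_add]; congr 1; omega
        rw [h2, this]
        cases s <;> cases (n - j).bodd <;> cases j.bodd <;> rfl
      · have := ih h3
        simpa [Nat.bodd_add] using this

/-- The words of maxima on `N` strings are permuted by the reflection. -/
theorem sum_capWords_reflect (adj : ∀ {s : Bool} {k : ℕ}, V s k → V s k)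
    (F : List (Slice V) → ℕ → M)
    (hF : ∀ w w' t, Exch w w' → F w t = F w' t) (N : ℕ) :
    ((capWords V 0 N).map fun c => F (reflectWord adj N c.1) c.2).sum =
      ((capWords V 0 N).map fun c => F c.1 c.2).sum := by
  induction N generalizing F with
  | zero => simp [capWords, reflectWord]
  | succ N ih =>
    rw [sum_capWords_succ]
    -- The string that is read last becomes the leftmost string in the mirror, and a maximum on it
    -- becomes `cap 0`.
    have h1 : ∀ c ∈ capWords V 0 N, (F (reflectWord adj (N + 1) c.1) (c.2 + 1) +
        if 0 < c.2 then F (reflectWord adj (N + 1) (c.1 ++ [Slice.cap (c.2 - 1)])) (c.2 - 1)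
          else 0) =
        F (shiftWord 1 (reflectWord adj N c.1)) (c.2 + 1) +
        if 0 < c.2 then F (shiftWord 1 (reflectWord adj N c.1) ++ [Slice.cap 0]) (c.2 - 1)
          else 0 := by
      intro c hc
      have hd := isDiagram_capWords hc true
      rw [zero_add] at hd
      have hd' := isDiagram_shiftWord (s := true) hd 0 1 (by simp)
      simp only [shiftWord_zero, zero_add] at hd'
      rw [reflectWord_append adj hd', add_comm N 1, reflectWord_add adj hd]
      split_ifs with h0
      · congr 4
        rw [reflectWord, reflectWord]
        congr 2
        omega
      · rfl
    rw [Multiset.map_congr rfl h1, ih fun w t => F (shiftWord 1 w) (t + 1) +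
        if 0 < t then F (shiftWord 1 w ++ [Slice.cap 0]) (t - 1) else 0]
    -- On the unreflected side the leftmost string is read first. Splitting with `h = 1` then leaves
    -- two cases, namely that this string stays open or is joined once: the same two terms.
    · rw [add_comm N 1, sum_capWords_add]
      simp only [capWords, Multiset.singleton_bind, Multiset.map_cons]
      simp only [lt_irrefl, if_false, Multiset.map_zero, Multiset.sum_cons, Multiset.sum_zero,
        add_zero, List.nil_append, zero_add]
      rw [sum_capWords_split F hF 1 N]
      congr 1
      refine Multiset.map_congr rfl fun c _ => ?_
      split_ifs with h0
      · rw [show min 1 c.2 + 1 = 2 by omega, Finset.sum_range_succ, Finset.sum_range_one]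
        simp only [nestedCaps, List.append_nil]
        rw [show 1 + c.2 - 2 * 0 = c.2 + 1 by omega, show 1 + c.2 - 2 * 1 = c.2 - 1 by omega]
      · rw [show min 1 c.2 + 1 = 1 by omega, Finset.sum_range_one]
        simp only [nestedCaps, List.append_nil]
        rw [show 1 + c.2 - 2 * 0 = c.2 + 1 by omega, add_zero]
    · intro w w' t hw
      rw [hF _ _ _ (hw.shiftWord 1), hF _ _ _ ((hw.shiftWord 1).append_right _)]

/-- Each maximum costs two strings, so only the empty word keeps all `N`. This is the diagonal part
of `X`. -/
theorem sum_capWords_top (N : ℕ) (F : List (Slice V) → M) :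
    ((capWords V 0 N).map fun c => if c.2 = N then F c.1 else 0).sum = F [] := by
  induction N with
  | zero => simp [capWords]
  | succ N ih =>
    rw [sum_capWords_succ, ← ih]
    congr 1
    refine Multiset.map_congr rfl fun c hc => ?_
    have := parity_capWords hc
    simp only [Nat.add_right_cancel_iff]
    rw [if_neg (show ¬ c.2 - 1 = N + 1 by omega)]
    simp

end Sums

end Words

/-! ### Temperley–Lieb diagrams and their right ends -/

/-- Reading a row of marked points from the left to the right, each right end finds an open
string. -/
def IsBalanced (l : List Bool) : Prop := ∀ p, p <+: l → 2 * p.count true ≤ p.length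

theorem isBalanced_concat (l : List Bool) (b : Bool) :
    IsBalanced (l ++ [b]) ↔
      IsBalanced l ∧ (b = true → 0 < l.length - 2 * l.count true) := by
  constructor
  · intro h
    refine ⟨fun p hp => h p (hp.trans (List.prefix_append _ _)), ?_⟩
    rintro rfl
    have := h _ List.prefix_rfl
    simp at this
    omega
  · rintro ⟨h, hb⟩ p hp
    rcases List.prefix_concat_iff.mp hp with rfl | hp
    · have h1 := h l List.prefix_rfl
      cases b
      · simp; omega
      · have := hb rfl
        simp; omega
    · exact h p hp

/-- A row of marked points determines a noncrossing partial matching. -/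
theorem exists_matching (l : List Bool) (hl : IsBalanced l) : ∃ f : ℕ → ℕ,
    (∀ p, f (f p) = p) ∧ (∀ p, l.length ≤ p → f p = p) ∧
    (∀ p, l[p]? = some true ↔ f p < p) ∧
    (∀ p q, ¬ (p < q ∧ q < f p ∧ f p < f q)) ∧ (∀ p q, p < q → q < f p → f q ≠ q) ∧
    ((Finset.range l.length).filter fun p => f p = p).card + 2 * l.count true = l.length := by
  induction l using List.reverseRecOn with
  | nil => exact ⟨id, by simp; constructor <;> intros <;> omega⟩
  | append_singleton l b ih =>
    obtain ⟨hl, hb⟩ := (isBalanced_concat l b).mp hl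
    -- The fixed points of `f` in the row are the open strings. The invariant `hnest`, that no arc
    -- covers an open string, is what keeps the induction free of crossings; `hcard` provides an
    -- open string whenever a right end is read.
    obtain ⟨f, hinv, hout, hmark, hcross, hnest, hcard⟩ := ih hl
    cases b with
    | false =>
      refine ⟨f, hinv, fun p hp => hout p (by simp at hp; omega), fun p => ?_, hcross, hnest, ?_⟩
      · rw [← hmark, List.getElem?_append]
        split_ifs with h
        · rfl
        · rw [List.getElem?_eq_none (not_lt.mp h)]
          cases p - l.length <;> simp
      · simp only [List.length_append, List.length_singleton, Finset.range_add_one,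
          Finset.filter_insert, hout _ le_rfl, if_true]
        rw [Finset.card_insert_of_notMem (by simp)]
        simp; omega
    | true =>
      have hb := hb rfl
      set n := l.length with hn
      have hne : ((Finset.range n).filter fun p => f p = p).Nonempty := by
        rw [← Finset.card_pos]; omega
      -- The new right end `n` is joined to the last open string `t`; by maximality no open string
      -- is trapped between `t` and `n`.
      obtain ⟨t, ht, hmax⟩ := Finset.exists_max_image _ id hne
      simp only [Finset.mem_filter, Finset.mem_range, id] at ht hmax
      obtain ⟨htn, htf⟩ := ht
      have hlt : ∀ p, p < n → f p < n := by
        intro p hp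
        by_contra h
        have h1 := hout _ (not_lt.mp h)
        rw [hinv] at h1
        omega
      have hft : ∀ p, p ≠ t → f p ≠ t := by
        intro p hp h
        apply hp
        rw [← hinv p, h, htf]
      have hfn : ∀ p, p ≠ n → f p ≠ n := by
        intro p hp h
        apply hp
        rw [← hinv p, h, hout n le_rfl]
      obtain ⟨g, hgt, hgn, hg⟩ : ∃ g : ℕ → ℕ, g t = n ∧ g n = t ∧
          ∀ p, p ≠ t → p ≠ n → g p = f p := by
        refine ⟨fun p => if p = t then n else if p = n then t else f p, by simp, ?_, ?_⟩
        · simp only [if_true]; rw [if_neg (by omega)]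
        · intro p h1 h2; simp [h1, h2]
      refine ⟨g, ?_, ?_, ?_, ?_, ?_, ?_⟩
      · intro p
        by_cases h1 : p = t
        · rw [h1, hgt, hgn]
        by_cases h2 : p = n
        · rw [h2, hgn, hgt]
        rw [hg p h1 h2, hg _ (hft p h1) (hfn p h2), hinv]
      · intro p hp
        simp only [List.length_append, List.length_singleton] at hp
        rw [hg p (by omega) (by omega), hout p (by omega)]
      · intro p
        rw [List.getElem?_append]
        split_ifs with h
        · rw [hmark]
          by_cases h1 : p = t
          · rw [h1, hgt, htf]; omega
          · rw [hg p h1 (by omega)]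
        · by_cases h2 : p = n
          · rw [h2, hgn]; simp [← hn, htn]
          · rw [hg p (by omega) h2, hout p (by omega)]
            rw [List.getElem?_eq_none (by simp; omega)]
            simp
      · rintro p q ⟨h1, h2, h3⟩
        by_cases hpn : p = n
        · rw [hpn, hgn] at h2; omega
        by_cases hqn : q = n
        · rw [hqn, hgn] at h3
          by_cases hpt : p = t
          · omega
          · rw [hg p hpt hpn] at h2
            have := hlt p (by omega)
            omega
        by_cases hpt : p = t
        · rw [hpt, hgt] at h2 h3
          rw [hg q (by omega) hqn] at h3
          have := hlt q h2
          omega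
        rw [hg p hpt hpn] at h2 h3
        by_cases hqt : q = t
        · rw [hqt] at h1 h2
          exact hnest p t h1 h2 htf
        rw [hg q hqt hqn] at h3
        exact hcross p q ⟨h1, h2, h3⟩
      · intro p q h1 h2 h3
        by_cases hpn : p = n
        · rw [hpn, hgn] at h2; omega
        by_cases hqn : q = n
        · rw [hqn, hgn] at h3; omega
        by_cases hqt : q = t
        · rw [hqt, hgt] at h3; omega
        rw [hg q hqt hqn] at h3
        by_cases hpt : p = t
        · rw [hpt, hgt] at h2
          have := hmax q ⟨h2, h3⟩
          omega
        rw [hg p hpt hpn] at h2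
        exact hnest p q h1 h2 h3
      · have hS : (Finset.range (l ++ [true]).length).filter (fun p => g p = p) =
            ((Finset.range n).filter fun p => f p = p).erase t := by
          ext p
          simp only [Finset.mem_filter, Finset.mem_range, Finset.mem_erase, List.length_append,
            List.length_singleton]
          by_cases h1 : p = t
          · rw [h1, hgt]; simp; omega
          by_cases h2 : p = n
          · rw [h2, hgn]; simp; omega
          rw [hg p h1 h2]
          simp [h1]; omega
        rw [hS, Finset.card_erase_of_mem (by simp [htn, htf])]
        simp
        have : 0 < ((Finset.range n).filter fun p => f p = p).card := Finset.card_pos.mpr hne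
        omega

namespace TLDiagram

variable {N M : ℕ}

/-- The boundary points of a diagram in clockwise order. -/
def rankEquiv (N M : ℕ) : Fin N ⊕ Fin M ≃ Fin (N + M) :=
  (Equiv.sumCongr (Equiv.refl _) Fin.revPerm).trans finSumFinEquiv

@[simp] theorem rankEquiv_inl (i : Fin N) : (rankEquiv N M (Sum.inl i) : ℕ) = i := by
  simp [rankEquiv]

@[simp] theorem rankEquiv_inr (j : Fin M) :
    (rankEquiv N M (Sum.inr j) : ℕ) = N + (M - 1 - (j : ℕ)) := by
  simp [rankEquiv, Fin.val_rev]; omega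

theorem rankEquiv_eq (p : Fin N ⊕ Fin M) : (rankEquiv N M p : ℕ) =
    Sum.elim (fun i : Fin N => (i : ℕ)) (fun j : Fin M => N + (M - 1 - (j : ℕ))) p := by
  cases p <;> simp

theorem noncrossing_rankEquiv (D : TLDiagram N M) (p q : Fin N ⊕ Fin M) :
    ¬ (rankEquiv N M p < rankEquiv N M q ∧ rankEquiv N M q < rankEquiv N M (D.partner p) ∧
      rankEquiv N M (D.partner p) < rankEquiv N M (D.partner q)) := by
  have := D.noncrossing p q
  simp only [Fin.lt_def, rankEquiv_eq]
  exact this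

/-- In clockwise order the top points come after the bottom points, and in an epi diagram each of
them is a right end. So `M` further marks are appended to the row: they close exactly the `M`
strings that are open, and the matching becomes perfect. Two top points cannot be partners, since
each would have to precede the other. -/
theorem exists_isRightEnd_eq (b : Fin N → Bool) (hb : IsBalanced (List.ofFn b))
    (hM : 2 * (List.ofFn b).count true + M = N) :
    ∃ D : TLDiagram N M, D.IsEpi ∧ D.isRightEnd = b := by
  have hbal : ∀ r, r ≤ M → IsBalanced (List.ofFn b ++ List.replicate r true) := by
    intro r
    induction r with
    | zero => simpa using hb
    | succ r ih =>
      intro hr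
      rw [List.replicate_succ', ← List.append_assoc, isBalanced_concat]
      refine ⟨ih (by omega), fun _ => ?_⟩
      simp only [List.length_append, List.length_ofFn, List.length_replicate, List.count_append,
        List.count_replicate_self]
      omega
  obtain ⟨f, hinv, hout, hmark, hcross, -, hcard⟩ := exists_matching _ (hbal M le_rfl)
  simp only [List.length_append, List.length_ofFn, List.length_replicate, List.count_append,
    List.count_replicate_self] at hout hcard
  have hfix : ∀ p, p < N + M → f p ≠ p := by
    intro p hp h
    have h0 : ((Finset.range (N + M)).filter fun p => f p = p).card = 0 := by omega
    rw [Finset.card_eq_zero] at h0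
    have : p ∈ (Finset.range (N + M)).filter fun p => f p = p := by simp [hp, h]
    rw [h0] at this
    simp at this
  have hlt : ∀ p, p < N + M → f p < N + M := by
    intro p hp
    by_contra h
    have h1 := hout _ (not_lt.mp h)
    rw [hinv] at h1
    omega
  have htop : ∀ p, N ≤ p → p < N + M → f p < p := by
    intro p h1 h2
    rw [← hmark, List.getElem?_append_right (by simpa using h1), List.getElem?_replicate]
    simp; omega
  let D : TLDiagram N M :=
    { partner := fun p => (rankEquiv N M).symm ⟨f (rankEquiv N M p), hlt _ (Fin.is_lt _)⟩
      partner_partner := fun p => by simp [hinv]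
      partner_ne := fun p h => by
        rw [Equiv.symm_apply_eq, Fin.ext_iff] at h
        exact hfix _ (Fin.is_lt _) h
      noncrossing := fun p q => by
        simp only [← rankEquiv_eq, Equiv.apply_symm_apply]
        exact hcross _ _ }
  have hD : ∀ p, (rankEquiv N M (D.partner p) : ℕ) = f (rankEquiv N M p) := fun p => by simp [D]
  refine ⟨D, fun j => ?_, ?_⟩
  · rcases h : D.partner (Sum.inr j) with i | i
    · exact ⟨i, rfl⟩
    · exfalso
      have h1 := hD (Sum.inr j)
      rw [h] at h1
      have h2 := htop _ (by simp) (Fin.is_lt (rankEquiv N M (Sum.inr j)))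
      have h3 := htop _ (by simp) (Fin.is_lt (rankEquiv N M (Sum.inr i)))
      rw [h1, hinv] at h3
      omega
  · funext i
    rw [Bool.eq_iff_iff, isRightEnd_iff]
    have h1 := hmark i
    rw [List.getElem?_append_left (by simp)] at h1
    simp only [List.getElem?_ofFn, i.is_lt, dif_pos, Fin.eta, Option.some.injEq] at h1
    rw [h1]
    have h2 := hD (Sum.inl i)
    rw [rankEquiv_inl] at h2
    rw [← h2]
    rcases D.partner (Sum.inl i) with a | a
    · simp
    · simp; omega

/-- A right end is joined to the nearest available point before it. Take the first right end `q` at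
which two diagrams differ, and let its partner in `E'` lie inside its arc in `E`. This point is no
right end, so by noncrossing `E` joins it to a right end strictly before `q`. There both diagrams
agree, so `E'` joins the point to something other than `q`, a contradiction. -/
theorem isRightEnd_injective {D D' : TLDiagram N M} (hD : D.IsEpi) (hD' : D'.IsEpi)
    (h : D.isRightEnd = D'.isRightEnd) : D = D' := by
  -- the right ends, in clockwise order
  have hR : ∀ (E : TLDiagram N M) (_ : E.IsEpi) (p : Fin N ⊕ Fin M),
      rankEquiv N M (E.partner p) < rankEquiv N M p ↔
        Sum.elim E.isRightEnd (fun _ => true) p = true := by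
    intro E hE p
    rcases p with i | j
    · rw [Sum.elim_inl, isRightEnd_iff, Fin.lt_def]
      rcases E.partner (Sum.inl i) with a | a
      · simp
      · simp; omega
    · obtain ⟨i, hi⟩ := hE j
      simp [hi, Fin.lt_def]; omega
  have hRR : ∀ p, rankEquiv N M (D.partner p) < rankEquiv N M p ↔
      rankEquiv N M (D'.partner p) < rankEquiv N M p := by
    intro p; rw [hR D hD, hR D' hD', h]
  -- the partners of right ends agree
  have key : ∀ (E E' : TLDiagram N M)
      (_ : ∀ p, rankEquiv N M (E.partner p) < rankEquiv N M p ↔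
        rankEquiv N M (E'.partner p) < rankEquiv N M p) (q : Fin N ⊕ Fin M)
      (_ : ∀ r, rankEquiv N M r < rankEquiv N M q → rankEquiv N M (E.partner r) < rankEquiv N M r →
        E.partner r = E'.partner r),
      rankEquiv N M (E'.partner q) < rankEquiv N M q →
      ¬ rankEquiv N M (E.partner q) < rankEquiv N M (E'.partner q) := by
    intro E E' hEE q hmin hq' hlt
    have hne : E.partner (E'.partner q) ≠ E'.partner q := E.partner_ne _
    have h1 : ¬ rankEquiv N M (E.partner (E'.partner q)) < rankEquiv N M (E'.partner q) := by
      rw [hEE, E'.partner_partner]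
      exact not_lt.mpr hq'.le
    have h1' : rankEquiv N M (E'.partner q) < rankEquiv N M (E.partner (E'.partner q)) :=
      lt_of_le_of_ne (not_lt.mp h1) fun h => hne ((rankEquiv N M).injective h).symm
    have h2 := E.noncrossing_rankEquiv (E.partner q) (E'.partner q)
    rw [E.partner_partner] at h2
    have h3 : rankEquiv N M (E.partner (E'.partner q)) < rankEquiv N M q := by
      refine lt_of_le_of_ne (not_lt.mp fun h => h2 ⟨hlt, hq', h⟩) fun h => ?_
      have := (rankEquiv N M).injective h
      rw [← this, E.partner_partner, this] at hlt
      exact lt_irrefl _ hlt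
    have h4 := hmin _ h3 (by rwa [E.partner_partner])
    rw [E.partner_partner] at h4
    have h5 := congrArg E'.partner h4
    rw [E'.partner_partner, E'.partner_partner] at h5
    rw [← h5] at h3
    exact lt_irrefl _ h3
  have hright : ∀ n : ℕ, ∀ q, (rankEquiv N M q : ℕ) = n →
      rankEquiv N M (D.partner q) < rankEquiv N M q → D.partner q = D'.partner q := by
    intro n
    induction n using Nat.strong_induction_on with
    | _ n ih =>
      rintro q rfl hq
      have h1 := key D D' hRR q (fun r hr hr' => ih _ hr r rfl hr') ((hRR q).mp hq)
      have h2 := key D' D (fun p => (hRR p).symm) q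
        (fun r hr hr' => (ih _ hr r rfl ((hRR r).mpr hr')).symm) hq
      exact (rankEquiv N M).injective (le_antisymm (not_lt.mp h2) (not_lt.mp h1))
  refine TLDiagram.ext (funext fun p => ?_)
  rcases lt_trichotomy (rankEquiv N M (D.partner p)) (rankEquiv N M p) with hp | hp | hp
  · exact hright _ p rfl hp
  · exact absurd ((rankEquiv N M).injective hp) (D.partner_ne p)
  · have := hright _ (D.partner p) rfl (by rwa [D.partner_partner])
    rw [D.partner_partner] at this
    rw [this, D'.partner_partner, ← this]

end TLDiagram

/-! ### Enumeration of epi diagrams by words of maxima -/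

section Sums

variable {V : Bool → ℕ → Type u} {M : Type*} [AddCommMonoid M]

/-- `scan` recurses from the left end of the row, whereas `capWords` grows at the right end; this
reconciles the two. The bound on prefixes makes all the truncated subtractions genuine. -/
theorem scan_append_singleton (h : ℕ) (l : List Bool) (b : Bool)
    (hl : ∀ p, p <+: l → 2 * p.count true ≤ h + p.length) :
    TLDiagram.scan (V := V) h (l ++ [b]) = TLDiagram.scan h l ++
      if b then [Slice.cap (h + l.length - 2 * l.count true - 1)] else [] := by
  induction l generalizing h with
  | nil => cases b <;> simp [TLDiagram.scan]
  | cons a l ih =>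
    cases a with
    | true =>
      have h1 := hl [true] (by simp)
      simp at h1
      have := ih (h - 1) (fun p hp => by
        have := hl (true :: p) (by simpa using hp)
        simp at this
        omega)
      simp only [List.cons_append, TLDiagram.scan, this, List.count_cons_self, List.length_cons]
      congr 6
      omega
    | false =>
      have := ih (h + 1) (fun p hp => by
        have := hl (false :: p) (by simpa using hp)
        simp at this
        omega)
      simp only [List.cons_append, TLDiagram.scan, this, List.length_cons]
      rw [show h + 1 + l.length = h + (l.length + 1) by omega]
      simp

open Classical in
-- The two choices in the recursion of `capWords` are the two values of the last mark, and the
-- condition that some string is open is exactly balance at that mark.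
theorem sum_capWords_eq_sum_balanced (N : ℕ) (F : List (Slice V) × ℕ → M) :
    ((capWords V 0 N).map F).sum = ∑ b : Fin N → Bool, if IsBalanced (List.ofFn b) then
      F (TLDiagram.scan 0 (List.ofFn b), N - 2 * (List.ofFn b).count true) else 0 := by
  induction N generalizing F with
  | zero => simp [capWords, IsBalanced, TLDiagram.scan]
  | succ N ih =>
    rw [sum_capWords_succ, ih, ← (Fin.snocEquiv fun _ => Bool).sum_comp, Fintype.sum_prod_type,
      Fintype.sum_bool, ← Finset.sum_add_distrib]
    refine Finset.sum_congr rfl fun b _ => ?_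
    have hsnoc : ∀ c, List.ofFn ((Fin.snocEquiv fun _ => Bool) (c, b)) = List.ofFn b ++ [c] := by
      intro c
      rw [List.ofFn_succ', List.concat_eq_append]
      simp
    simp only [hsnoc, isBalanced_concat, List.length_ofFn]
    by_cases hb : IsBalanced (List.ofFn b)
    · have hle := hb _ List.prefix_rfl
      have hscan := fun c => scan_append_singleton (V := V) 0 (List.ofFn b) c
        (by simpa [IsBalanced] using hb)
      rw [List.length_ofFn] at hle
      simp only [hb, true_and, if_true, forall_true_left, Bool.false_eq_true, false_imp_iff,
        hscan, if_false, List.append_nil, List.length_ofFn, zero_add]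
      rw [add_comm]
      congr 1
      · refine if_congr Iff.rfl ?_ rfl
        congr 2
        simp; omega
      · congr 2
        simp; omega
    · simp [hb]

open Classical in
/-- The epi diagrams are enumerated by the words of maxima. -/
theorem sum_epi_eq_sum_capWords (N K : ℕ) (F : List (Slice V) → M) :
    ∑ D : {D : TLDiagram N K // D.IsEpi}, F D.1.word =
      ((capWords V 0 N).map fun c => if c.2 = K then F c.1 else 0).sum := by
  rw [sum_capWords_eq_sum_balanced]
  simp only [← ite_and]
  rw [← Finset.sum_filter]
  refine Finset.sum_bij (fun D _ => D.1.isRightEnd) (fun D _ => ?_) (fun D _ D' _ h => ?_)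
    (fun b hb => ?_) (fun D _ => rfl)
  · have h1 := D.1.two_mul_count_add D.2
    rw [Finset.mem_filter]
    exact ⟨Finset.mem_univ _, fun p hp => D.1.two_mul_count_le p hp, by omega⟩
  · exact Subtype.ext (TLDiagram.isRightEnd_injective D.2 D'.2 h)
  · rw [Finset.mem_filter] at hb
    have hle := hb.2.1 _ List.prefix_rfl
    rw [List.length_ofFn] at hle
    obtain ⟨D, hD, rfl⟩ := TLDiagram.exists_isRightEnd_eq (M := K) b hb.2.1
      (by have := hb.2.2; omega)
    exact ⟨⟨D, hD⟩, Finset.mem_univ _, rfl⟩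

end Sums

/-! ### Evaluation of words -/

namespace PlanarStarAlgebra

variable (P : PlanarStarAlgebra.{u})

open Classical in
/-- The value of a word, or `0` if the word is not a tangle. -/
noncomputable def eval (s : Bool) (N : ℕ) (w : List (Slice P.V)) : P.V s N :=
  if h : IsDiagram s 0 w (2 * N) then P.Z ⟨w, h⟩ else 0

variable {P}

theorem eval_eq_Z {s : Bool} {N : ℕ} (T : Tangle P.V s N) : P.Z T = P.eval s N T.word := by
  rw [eval, dif_pos T.valid]

/-- Validity is compared only from the row of `n` strings upwards; if it fails, both values are `0`
by convention. -/
theorem eval_congr_move {s : Bool} {N n : ℕ} {u v w w' : List (Slice P.V)} (hm : Move w w')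
    (hu : IsDiagram s 0 u n)
    (h : ∀ m, IsDiagram s n (w ++ v) m ↔ IsDiagram s n (w' ++ v) m) :
    P.eval s N (u ++ (w ++ v)) = P.eval s N (u ++ (w' ++ v)) := by
  unfold eval
  by_cases h1 : IsDiagram s 0 (u ++ (w ++ v)) (2 * N)
  · have h2 : IsDiagram s 0 (u ++ (w' ++ v)) (2 * N) := by
      rwa [isDiagram_append_left_iff hu, ← h, ← isDiagram_append_left_iff hu]
    rw [dif_pos h1, dif_pos h2]
    exact P.Z_isotopy u v w w' _ _ hm (List.append_assoc _ _ _).symm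
      (List.append_assoc _ _ _).symm
  · have h2 : ¬ IsDiagram s 0 (u ++ (w' ++ v)) (2 * N) := by
      rwa [isDiagram_append_left_iff hu, ← h, ← isDiagram_append_left_iff hu]
    rw [dif_neg h1, dif_neg h2]

theorem eval_eq_zero {s : Bool} {N : ℕ} {w : List (Slice P.V)}
    (h : ¬ IsDiagram s 0 w (2 * N)) : P.eval s N w = 0 := dif_neg h

theorem eval_exch {w w' : List (Slice P.V)} (h : Exch w w') (s : Bool) (N : ℕ) :
    P.eval s N w = P.eval s N w' := by
  induction h with
  | step u v A B h =>
    by_cases hu : ∃ n, IsDiagram s 0 u n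
    · obtain ⟨n, hu⟩ := hu
      exact eval_congr_move (Move.exchange A B h) hu
        fun m => isDiagram_exchange_iff s n m A B h v
    · rw [eval_eq_zero, eval_eq_zero]
      all_goals
        rw [isDiagram_append_iff]
        rintro ⟨l, hl, -⟩
        exact hu ⟨l, hl⟩
  | refl w => rfl
  | symm _ ih => exact ih.symm
  | trans _ _ ih ih' => exact ih.trans ih'

theorem eval_zigzag {s : Bool} {N n j : ℕ} {u : List (Slice P.V)} (hu : IsDiagram s 0 u n)
    (hj : j + 1 ≤ n) (v : List (Slice P.V)) :
    P.eval s N (u ++ ([Slice.cup (j + 1), Slice.cap j] ++ v)) = P.eval s N (u ++ v) := by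
  refine eval_congr_move (Move.zigzag_right j) hu fun m => ?_
  simp only [IsDiagram, List.cons_append, List.nil_append]
  exact ⟨fun h => h.2.2, fun h => ⟨hj, by omega, h⟩⟩

/-- A maximum on the left ends of nested minima slides to their right ends. -/
theorem eval_nestedCups_cap {s : Bool} {N n j : ℕ} {u : List (Slice P.V)}
    (hu : IsDiagram s 0 u n) (hj : j ≤ n) (a r : ℕ) (v : List (Slice P.V)) :
    P.eval s N (u ++ (nestedCups j (a + 2 + r) ++ (Slice.cap (j + a) :: v))) =
      P.eval s N (u ++ (nestedCups j (a + r) ++ (Slice.cup (j + a + 2 * r) :: v))) := by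
  -- The maximum first drops below the `r` inner minima and straightens a zigzag with one of the two
  -- minima it meets. The other minimum then rises past the inner ones on their right (`e2`).
  have e1 : Exch (nestedCups (j + a + 2) r ++ [Slice.cap (V := P.V) (j + a)])
      (Slice.cap (j + a) :: nestedCups (j + a) r) := by
    have h1 : IsDiagram (V := P.V) s (j + a + 2) [Slice.cap (j + a)] (j + a) :=
      ⟨le_rfl, by simp [IsDiagram]⟩
    have := Exch.interchange h1 (nestedCups 0 r)
    simpa only [shiftWord_nestedCups, add_zero, List.singleton_append] using this.symm
  have e2 : Exch (Slice.cup (V := P.V) (j + a) :: nestedCups (j + a) r)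
      (nestedCups (j + a) r ++ [Slice.cup (j + a + 2 * r)]) := by
    have := (Exch.nestedCups_comm (j + a) r [Slice.cup (V := P.V) 0]).symm
    simpa [Slice.shift] using this
  have h1 := eval_exch (((e1.append_left (u ++ (nestedCups j a ++
    [Slice.cup (j + a), Slice.cup (j + a + 1)]))).append_right v)) s N
  have h2 := eval_zigzag (N := N) (j := j + a)
    (u := u ++ (nestedCups j a ++ [Slice.cup (j + a)])) (n := n + 2 * a + 2)
    (isDiagram_append _ _ _ _ n _ hu (isDiagram_append _ _ _ _ (n + 2 * a) _
      (isDiagram_nestedCups s j a n _ hj rfl)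
      ⟨by omega, by simp [IsDiagram]⟩)) (by omega) (nestedCups (j + a) r ++ v)
  have h3 := eval_exch ((e2.append_left (u ++ nestedCups j a)).append_right v) s N
  rw [add_assoc a 2 r, nestedCups_add, nestedCups_add (j + a) 2 r, nestedCups_add j a r]
  simp only [nestedCups, List.append_assoc, List.cons_append, List.nil_append] at h1 h2 h3 ⊢
  rw [h1, h2, h3]

/-- A minimum on the right ends of nested maxima slides to their left ends. -/
theorem eval_cup_nestedCaps {s : Bool} {N n j a r : ℕ} {u : List (Slice P.V)}
    (hu : IsDiagram s 0 u n) (hj : j + 2 * r + 2 * a + 2 ≤ n) (v : List (Slice P.V)) :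
    P.eval s N (u ++ (Slice.cup (j + a + 2 + 2 * r) :: (nestedCaps j (a + 2 + r) ++ v))) =
      P.eval s N (u ++ (Slice.cap (j + a) :: (nestedCaps j (a + r) ++ v))) := by
  have e1 : Exch (Slice.cup (V := P.V) (j + a + 2 + 2 * r) :: nestedCaps (j + a + 2) r)
      (nestedCaps (j + a + 2) r ++ [Slice.cup (j + a + 2)]) := by
    have := (Exch.nestedCaps_comm (j + a + 2) r [Slice.cup (V := P.V) 0]).symm
    simpa [Slice.shift] using this
  have e2 : Exch (nestedCaps (j + a + 2) r ++ [Slice.cap (V := P.V) (j + a)])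
      (Slice.cap (j + a) :: nestedCaps (j + a) r) := by
    have h1 : IsDiagram (V := P.V) s (j + a + 2) [Slice.cap (j + a)] (j + a) :=
      ⟨le_rfl, by simp [IsDiagram]⟩
    have := Exch.interchange h1 (nestedCaps 0 r)
    simpa only [shiftWord_nestedCaps, add_zero, List.singleton_append] using this.symm
  have h1 := eval_exch ((e1.append_left u).append_right (nestedCaps j (a + 2) ++ v)) s N
  have h2 := eval_zigzag (N := N) (j := j + a + 1) (u := u ++ nestedCaps (j + a + 2) r)
    (n := n - 2 * r)
    (isDiagram_append _ _ _ _ n _ hu (isDiagram_nestedCaps s _ r n _ (by omega) (by omega)))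
    (by omega) (Slice.cap (j + a) :: (nestedCaps j a ++ v))
  have h3 := eval_exch ((e2.append_left u).append_right (nestedCaps j a ++ v)) s N
  rw [nestedCaps_add j (a + 2) r, nestedCaps_add j a r]
  simp only [nestedCaps, List.append_assoc, List.cons_append, List.nil_append,
    ← add_assoc] at h1 h2 h3 ⊢
  rw [h1, h2, h3]

/-- A word of maxima passes through the rotation. -/
theorem eval_rotate_capWord {s : Bool} {K c N t : ℕ} {w : List (Slice P.V)}
    (hw : IsDiagram s N w t) (hcap : ∀ A ∈ w, ∃ a, A = Slice.cap a) {Y : List (Slice P.V)}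
    (hY : IsDiagram s 0 Y (c + N)) (hs : N.bodd = false) :
    P.eval s K (nestedCups 0 N ++ (shiftWord N Y ++ (nestedCaps (N + c) N ++ w))) =
      P.eval s K (nestedCups 0 t ++ (shiftWord t (Y ++ shiftWord c w) ++ nestedCaps (t + c) t)) := by
  induction w generalizing N Y with
  | nil => cases hw; simp
  | cons A w ih =>
    obtain ⟨a, rfl⟩ := hcap A (by simp)
    obtain ⟨ha, hw⟩ := hw
    obtain ⟨r, rfl⟩ : ∃ r, N = a + 2 + r := ⟨N - (a + 2), by omega⟩
    have hsub : a + 2 + r - 2 = a + r := by omega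
    rw [hsub] at hw
    have hs' : (a + r).bodd = false := by
      rw [show a + 2 + r = a + r + 2 by omega, Nat.bodd_add] at hs
      simpa using hs
    -- The first maximum of `w` is absorbed into `Y`: it drops to the nested minima (`e1`), turns
    -- into a minimum on their right ends (`h2`), rises past `Y` (`e2`), and becomes a maximum on
    -- the last points of `Y` (`h4`). The nest has then lost two strings, so its length stays even
    -- and the shade of `Y` is unaffected.
    have h0 := ih hw (fun A hA => hcap A (by simp [hA])) (Y := Y ++ [Slice.cap (c + a)])
      (isDiagram_append _ _ _ _ _ _ hY ⟨by omega, by simp [IsDiagram]; omega⟩) hs'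
    have e1 : Exch ([Slice.cap (V := P.V) a] ++ shiftWord (a + r) (Y ++ nestedCaps c (a + 2 + r)))
        (shiftWord (a + 2 + r) (Y ++ nestedCaps c (a + 2 + r)) ++ [Slice.cap a]) :=
      Exch.interchange (s := s) (show IsDiagram s (a + 2 + r) [Slice.cap a] (a + r) from
        ⟨by omega, by simp [IsDiagram]; omega⟩) _
    have hYd : IsDiagram s (a + r) (shiftWord (a + r) Y) (a + r + (c + (a + 2 + r))) := by
      simpa using isDiagram_shiftWord (s := s) hY (a + r) 0 (by simp [hs'])
    have e2 : Exch ([Slice.cup (a + 2 * r)] ++ shiftWord (a + r) Y)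
        (shiftWord (a + r) Y ++ [Slice.cup (a + r + c + a + 2 + 2 * r)]) := by
      have := (Exch.interchange hYd [Slice.cup r]).symm
      simp only [shiftWord_cons, Slice.shift, shiftWord_nil] at this
      convert this using 4 <;> ring
    have h1 := eval_exch ((e1.append_left (nestedCups 0 (a + 2 + r))).append_right w) s K
    have h2 := eval_nestedCups_cap (N := K) (s := s) (u := []) (n := 0) (j := 0) rfl le_rfl a r
      (shiftWord (a + r) (Y ++ nestedCaps c (a + 2 + r)) ++ w)
    have h3 := eval_exch ((e2.append_left (nestedCups 0 (a + r))).append_right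
      (nestedCaps (a + r + c) (a + 2 + r) ++ w)) s K
    have h4 := eval_cup_nestedCaps (N := K) (j := a + r + c) (a := a) (r := r)
      (u := nestedCups 0 (a + r) ++ shiftWord (a + r) Y) (s := s)
      (isDiagram_append s _ _ _ _ _ (isDiagram_nestedCups s 0 (a + r) 0 (a + r + 0 + (a + r)) le_rfl (by omega))
        (isDiagram_shiftWord (s := s) hY (a + r) (a + r) (by simp [hs'])))
      (by omega) w
    simp only [shiftWord_append, shiftWord_cons, shiftWord_nil, shiftWord_nestedCaps, Slice.shift,
      List.append_assoc, List.cons_append, List.nil_append, zero_add, ← add_assoc] at h0 h1 h2 h3 h4 ⊢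
    rw [← h1, h2, h3, h4, h0]

theorem isDiagram_comp {s t : Bool} {m j N : ℕ} {u v R : List (Slice P.V)}
    (hR : IsDiagram t 0 R (2 * m)) (y : P.V t m)
    (hT : IsDiagram s 0 (u ++ Slice.box j y :: v) N) :
    IsDiagram s 0 (u ++ (shiftWord j R ++ v)) N := by
  rw [isDiagram_append_iff] at hT ⊢
  obtain ⟨l, hu, h1, h2, h3⟩ := hT
  refine ⟨l, hu, isDiagram_append s _ _ _ (l + 2 * m) _ ?_ h3⟩
  have := isDiagram_shiftWord (s := s) hR j (l - j) h2
  rwa [show j + 0 + (l - j) = l by omega, show j + 2 * m + (l - j) = l + 2 * m by omega] at this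

theorem eval_comp {s t : Bool} {m j N : ℕ} {u v R : List (Slice P.V)}
    (hR : IsDiagram t 0 R (2 * m))
    (hT : IsDiagram s 0 (u ++ Slice.box j (P.eval t m R) :: v) (2 * N)) :
    P.eval s N (u ++ Slice.box j (P.eval t m R) :: v) = P.eval s N (u ++ (shiftWord j R ++ v)) := by
  have h2 := isDiagram_comp hR _ hT
  have h3 : P.eval t m R = P.Z ⟨R, hR⟩ := (eval_eq_Z (P := P) ⟨R, hR⟩).symm
  rw [← eval_eq_Z ⟨_, hT⟩, ← eval_eq_Z ⟨_, h2⟩]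
  exact P.Z_comp u v j ⟨R, hR⟩ _ _ (congrArg (fun y => u ++ Slice.box j y :: v) h3)
    (List.append_assoc _ _ _).symm

theorem eval_add {s t : Bool} {m j N : ℕ} (u v : List (Slice P.V)) (x y : P.V t m) :
    P.eval s N (u ++ Slice.box j (x + y) :: v) =
      P.eval s N (u ++ Slice.box j x :: v) + P.eval s N (u ++ Slice.box j y :: v) := by
  have key : ∀ z : P.V t m, IsDiagram s 0 (u ++ Slice.box j z :: v) (2 * N) ↔
      IsDiagram s 0 (u ++ Slice.box j x :: v) (2 * N) := by
    intro z; simp [isDiagram_append_iff, IsDiagram]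
  by_cases h : IsDiagram s 0 (u ++ Slice.box j x :: v) (2 * N)
  · rw [← eval_eq_Z ⟨_, h⟩, ← eval_eq_Z ⟨_, (key y).mpr h⟩, ← eval_eq_Z ⟨_, (key (x + y)).mpr h⟩]
    exact P.Z_add u v j x y _ _ _ rfl rfl rfl
  · rw [eval_eq_zero h, eval_eq_zero fun h' => h ((key _).mp h'),
      eval_eq_zero fun h' => h ((key _).mp h'), add_zero]

theorem eval_reflectWord {s : Bool} {N : ℕ} {w : List (Slice P.V)}
    (h : IsDiagram s 0 w (2 * N)) :
    P.eval s N (reflectWord P.adj 0 w) = P.adj (P.eval s N w) := by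
  have h2 := isDiagram_reflectWord P.adj h
  rw [Nat.bodd_zero, Bool.xor_false] at h2
  rw [← eval_eq_Z ⟨_, h⟩, ← eval_eq_Z ⟨_, h2⟩]
  exact P.Z_adj _ _ rfl

theorem adj_zero {s : Bool} {n : ℕ} : P.adj (0 : P.V s n) = 0 := by
  have := P.adj_add (0 : P.V s n) 0
  simpa using this

end PlanarStarAlgebra

/-! ### Values of closed diagrams -/

namespace SubfactorPlanarAlgebra

variable (P : SubfactorPlanarAlgebra.{u})

/-- A disc labelled by the empty tangle can be inserted next to any closed diagram without changing
its value. If that label were `0`, linearity would make the whole one-dimensional space vanish. -/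
theorem Z_empty_ne_zero (s : Bool) : P.Z (Tangle.empty P.V s) ≠ 0 := by
  intro h
  have h1 : ∀ x : P.V s 0, x = 0 := by
    intro x
    rw [← P.Z_identity x, ← P.Z_comp [] [Slice.box 0 x] 0 (Tangle.empty P.V s)
      ⟨[Slice.box 0 (P.Z (Tangle.empty P.V s)), Slice.box 0 x], by simp [IsDiagram]⟩ _ rfl rfl]
    rw [P.Z_smul [] [Slice.box 0 x] 0 0 0 _ ⟨[Slice.box 0 (0 : P.V s 0), Slice.box 0 x],
      by simp [IsDiagram]⟩ (by rw [h, smul_zero]; rfl) rfl, zero_smul]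
  have h2 := P.finrank_zero s
  have : Subsingleton (P.V s 0) := ⟨fun x y => by rw [h1 x, h1 y]⟩
  rw [Module.finrank_zero_of_subsingleton] at h2
  exact zero_ne_one h2

theorem scalar_smul {s : Bool} (x : P.V s 0) :
    P.scalar x • P.Z (Tangle.empty P.V s) = x := by
  have h : ∃ c : ℂ, x = c • P.Z (Tangle.empty P.V s) := by
    obtain ⟨c, hc⟩ := (finrank_eq_one_iff_of_nonzero' _ (P.Z_empty_ne_zero s)).mp
      (P.finrank_zero s) x
    exact ⟨c, hc.symm⟩
  rw [PlanarStarAlgebra.scalar, dif_pos h]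
  exact h.choose_spec.symm

/-- The value of a closed diagram, as an additive map. -/
noncomputable def scalarHom (s : Bool) : P.V s 0 →+ ℂ :=
  AddMonoidHom.mk' (fun x => P.scalar x) fun x y => by
    apply smul_left_injective ℂ (P.Z_empty_ne_zero s)
    simp only [add_smul, scalar_smul]

end SubfactorPlanarAlgebra

/-! ### Biadditive maps on direct sums -/

section Biadditive

variable {A B : ℕ → Type*} {M : Type*} [∀ n, AddCommGroup (A n)] [∀ n, AddCommGroup (B n)]
  [AddCommGroup M]

open Classical in
/-- A family of biadditive maps, extended to direct sums. -/
noncomputable def biadditiveSum (φ : ∀ m n, A m → B n → M)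
    (hl : ∀ m n x x' y, φ m n (x + x') y = φ m n x y + φ m n x' y)
    (hr : ∀ m n x y y', φ m n x (y + y') = φ m n x y + φ m n x y') :
    (Π₀ n, A n) →+ (Π₀ n, B n) →+ M :=
  have hl0 : ∀ m n y, φ m n 0 y = 0 := fun m n y => by simpa using hl m n 0 0 y
  have hr0 : ∀ m n x, φ m n x 0 = 0 := fun m n x => by simpa using hr m n x 0 0
  AddMonoidHom.mk' (fun a => AddMonoidHom.mk'
      (fun b : Π₀ n, B n => a.sum fun m x => b.sum fun n y => φ m n x y) (fun b b' => by
        rw [← DFinsupp.sum_add]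
        congr 1
        funext m x
        exact DFinsupp.sum_add_index (fun n => hr0 m n x) fun n y y' => hr m n x y y'))
    fun a a' => by
      refine AddMonoidHom.ext fun b => ?_
      refine DFinsupp.sum_add_index (f := a) (g := a')
        (h := fun m x => b.sum fun n y => φ m n x y) (fun m => ?_) fun m x x' => ?_
      · simp [hl0, DFinsupp.sum]
      · rw [← DFinsupp.sum_add]
        congr 1
        funext n y
        exact hl m n x x' y

theorem biadditiveSum_single (φ : ∀ m n, A m → B n → M) (hl hr) (m n : ℕ) (x : A m) (y : B n) :
    biadditiveSum φ hl hr (DFinsupp.single m x) (DFinsupp.single n y) = φ m n x y := by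
  classical
  have hl0 : ∀ m n y, φ m n 0 y = 0 := fun m n y => by simpa using hl m n 0 0 y
  have hr0 : ∀ m n x, φ m n x 0 = 0 := fun m n x => by simpa using hr m n x 0 0
  simp only [biadditiveSum, AddMonoidHom.mk'_apply]
  rw [DFinsupp.sum_single_index, DFinsupp.sum_single_index]
  · exact hr0 _ _ _
  · simp [hl0, DFinsupp.sum]

theorem eq_of_eq_on_single {f g : (Π₀ n, A n) → M} (hf : ∀ a b, f (a + b) = f a + f b)
    (hg : ∀ a b, g (a + b) = g a + g b)
    (h : ∀ n x, f (DFinsupp.single n x) = g (DFinsupp.single n x)) (a : Π₀ n, A n) :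
    f a = g a :=
  DFunLike.congr_fun
    (DFinsupp.addHom_ext (f := AddMonoidHom.mk' f hf) (g := AddMonoidHom.mk' g hg) h) a

end Biadditive

/-- A unitriangular endomorphism of a direct sum is bijective. -/
theorem bijective_of_unitriangular {A : ℕ → Type*} [∀ n, AddCommGroup (A n)] [∀ n, Module ℂ (A n)]
    (f : (Π₀ n, A n) →ₗ[ℂ] Π₀ n, A n)
    (hf : ∀ i (x : A i) n, i ≤ n → f (DFinsupp.single i x) n = DFinsupp.single i x n) :
    Function.Bijective f := by
  classical
  have hsum : ∀ (a : Π₀ n, A n) (N : ℕ), (∀ n, N ≤ n → a n = 0) →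
      a = ∑ n ∈ Finset.range N, DFinsupp.single n (a n) := by
    intro a N ha
    ext n
    rw [DFinsupp.finsetSum_apply]
    by_cases hn : n < N
    · rw [Finset.sum_eq_single n]
      · simp
      · intro m _ hm; simp [DFinsupp.single_apply, hm]
      · simp [hn]
    · rw [ha n (by omega), Finset.sum_eq_zero]
      intro m hm
      rw [Finset.mem_range] at hm
      rw [DFinsupp.single_eq_of_ne (by omega)]
  have hbd : ∀ a : Π₀ n, A n, ∃ N, ∀ n, N ≤ n → a n = 0 := by
    intro a
    refine ⟨a.support.sup id + 1, fun n hn => ?_⟩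
    by_contra h
    have : n ≤ a.support.sup id :=
      Finset.le_sup (f := id) (by rw [DFinsupp.mem_support_toFun]; exact h)
    omega
  constructor
  · rw [injective_iff_map_eq_zero]
    intro a ha
    obtain ⟨N, hN⟩ := hbd a
    induction N with
    | zero => ext n; simpa using hN n (Nat.zero_le n)
    | succ N ih =>
      refine ih fun n hn => ?_
      rcases eq_or_lt_of_le hn with rfl | hlt
      -- The component of `a` in the highest degree is seen unchanged in `f a`.
      · have h1 : f a N = a N := by
          conv_lhs => rw [hsum a (N + 1) hN]
          rw [map_sum, DFinsupp.finsetSum_apply, Finset.sum_eq_single N]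
          · rw [hf N _ N le_rfl]; simp
          · intro m hm hne
            rw [Finset.mem_range] at hm
            rw [hf m _ N (by omega), DFinsupp.single_eq_of_ne (by omega)]
          · simp
        rw [← h1, ha]; rfl
      · exact hN n (by omega)
  · have key : ∀ N, ∀ a : Π₀ n, A n, (∀ n, N ≤ n → a n = 0) → a ∈ LinearMap.range f := by
      intro N
      induction N with
      | zero =>
        intro a ha
        rw [hsum a 0 ha]
        simp
      | succ N ih =>
        intro a ha
        -- Subtracting the image of the leading component lowers the bound on the degree.
        have h1 : a - f (DFinsupp.single N (a N)) ∈ LinearMap.range f := by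
          refine ih _ fun n hn => ?_
          rw [DFinsupp.sub_apply, hf N _ n hn]
          rcases eq_or_lt_of_le hn with rfl | hlt
          · simp
          · rw [ha n (by omega), DFinsupp.single_eq_of_ne (by omega), sub_zero]
        have := Submodule.add_mem _ h1 (LinearMap.mem_range_self f (DFinsupp.single N (a N)))
        simpa using this
    intro a
    obtain ⟨N, hN⟩ := hbd a
    exact key N a hN

/-! ### `X` on homogeneous elements, and its bijectivity -/

namespace SubfactorPlanarAlgebra

open PlanarStarAlgebra

variable (P : SubfactorPlanarAlgebra.{u}) (k : ℕ)

/-- The value of a word with `t + 2 * k` upper strings, in the part of degree `t / 2`. -/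
noncomputable def gradedEval (w : List (Slice P.V)) (t : ℕ) : P.Gr k :=
  DFinsupp.single (t / 2) (P.eval true (t / 2 + k) w)

theorem gradedEval_exch {w w' : List (Slice P.V)} (h : Exch w w') (t : ℕ) :
    P.gradedEval k w t = P.gradedEval k w' t := by
  rw [gradedEval, gradedEval, eval_exch h]

/-- The transport between equal degrees takes place here. Afterwards the degree is just a number
next to a word and can be rewritten freely. -/
theorem single_Z {s : List (Slice P.V)} {n t : ℕ} (T : Tangle P.V true (n + k)) (hT : T.word = s)
    (h : t = 2 * n) : (DFinsupp.single n (P.Z T) : P.Gr k) = P.gradedEval k s t := by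
  have h1 : n = t / 2 := by omega
  subst h1
  rw [gradedEval, eval_eq_Z, hT]

/-- After the sums over `j` and over words are interchanged, each word `c` survives only for `j =
c.2 / 2`; parity makes `c.2` even and at most `2 * i`. -/
theorem X_single (i : ℕ) (x : P.V true (i + k)) :
    P.X k (DFinsupp.single i x) = ((capWords P.V 0 (2 * i)).map fun c =>
      P.gradedEval k (Slice.box 0 x :: c.1) c.2).sum := by
  classical
  rw [X, DFinsupp.lsum_single]
  simp only [LinearMap.sum_apply, LinearMap.comp_apply]
  have h1 : ∀ j, ∑ E : {E : TLDiagram (2 * i) (2 * j) // E.IsEpi},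
      DFinsupp.lsingle (R := ℂ) (M := fun n : ℕ => P.V true (n + k)) j (P.actTL k E.1 E.2 x) =
      ((capWords P.V 0 (2 * i)).map fun c =>
        if c.2 = 2 * j then P.gradedEval k (Slice.box 0 x :: c.1) (2 * j) else 0).sum := by
    intro j
    rw [← sum_epi_eq_sum_capWords (2 * i) (2 * j)
      fun w => P.gradedEval k (Slice.box 0 x :: w) (2 * j)]
    refine Finset.sum_congr (by congr) fun E _ => ?_
    exact P.single_Z k (Tangle.applyTL k E.1 E.2 x) rfl rfl
  refine (Finset.sum_congr rfl fun j _ => h1 j).trans ?_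
  refine (Multiset.sum_map_sum_map (Finset.range (i + 1)).val _).trans ?_
  refine congrArg Multiset.sum (Multiset.map_congr rfl fun c hc => ?_)
  have hp := parity_capWords hc
  show ∑ j ∈ Finset.range (i + 1), _ = _
  rw [Finset.sum_eq_single (c.2 / 2)]
  · rw [if_pos (by omega), show 2 * (c.2 / 2) = c.2 by omega]
  · intro j _ hj
    rw [if_neg (by omega)]
  · intro h
    rw [Finset.mem_range] at h
    omega

theorem gradedEval_box (n : ℕ) (x : P.V true (n + k)) :
    P.gradedEval k [Slice.box 0 x] (2 * n) = DFinsupp.single n x := by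
  rw [← P.single_Z k (s := [Slice.box 0 x]) (n := n) (Tangle.identity x) rfl rfl, P.Z_identity]

theorem X_bijective : Function.Bijective (P.X k) := by
  classical
  refine bijective_of_unitriangular _ fun i x n hn => ?_
  have h1 : ((P.X k (DFinsupp.single i x) : P.Gr k) n) =
      ((capWords P.V 0 (2 * i)).map fun c =>
        (P.gradedEval k (Slice.box 0 x :: c.1) c.2) n).sum := by
    rw [X_single]
    refine (map_multiset_sum
      (DFinsupp.evalAddMonoidHom (β := fun n => P.V true (n + k)) n) _).trans ?_
    rw [Multiset.map_map]
    rfl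
  have h2 : ∀ c ∈ capWords P.V 0 (2 * i), (P.gradedEval k (Slice.box 0 x :: c.1) c.2) n =
      if c.2 = 2 * i then (P.gradedEval k (Slice.box 0 x :: c.1) (2 * i)) n else 0 := by
    intro c hc
    have hp := parity_capWords hc
    split_ifs with h
    · rw [h]
    · rw [gradedEval, DFinsupp.single_eq_of_ne (by omega)]
  rw [h1, Multiset.map_congr rfl h2,
    sum_capWords_top (2 * i) fun w => (P.gradedEval k (Slice.box 0 x :: w) (2 * i)) n]
  rw [gradedEval_box]

theorem X_one : P.X k (P.one k) = P.one k := by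
  rw [one, X_single]
  simp only [capWords, Multiset.map_singleton, Multiset.sum_singleton]
  exact P.gradedEval_box k 0 _

end SubfactorPlanarAlgebra

/-! ### Gluing tangles into boxes -/

section CapWords

variable {V : Bool → ℕ → Type u}

theorem isDiagram_shiftWord_capWords {N : ℕ} {c : List (Slice V) × ℕ} (hc : c ∈ capWords V 0 N)
    (s : Bool) (d R : ℕ) : IsDiagram s (d + N + R) (shiftWord d c.1) (d + c.2 + R) := by
  have := isDiagram_capWords hc (xor s d.bodd)
  rw [zero_add] at this
  exact isDiagram_shiftWord this d R rfl

theorem eq_cap_of_mem_capWords {h N : ℕ} {c : List (Slice V) × ℕ} (hc : c ∈ capWords V h N) :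
    ∀ A ∈ c.1, ∃ a, A = Slice.cap a := by
  induction N generalizing c with
  | zero =>
    simp only [capWords, Multiset.mem_singleton] at hc
    subst hc; simp
  | succ N ih =>
    simp only [capWords, Multiset.mem_bind, Multiset.mem_cons] at hc
    obtain ⟨c', hc', rfl | hc⟩ := hc
    · exact ih (c := c') hc'
    · split_ifs at hc
      · rw [Multiset.mem_singleton] at hc
        subst hc
        intro A hA
        rcases List.mem_append.mp hA with hA | hA
        · exact ih hc' A hA
        · exact ⟨_, List.mem_singleton.mp hA⟩
      · simp at hc

end CapWords

namespace SubfactorPlanarAlgebra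

open PlanarStarAlgebra

variable (P : SubfactorPlanarAlgebra.{u}) (k : ℕ)

theorem gradedEval_two_mul (w : List (Slice P.V)) (n : ℕ) :
    P.gradedEval k w (2 * n) = DFinsupp.single n (P.eval true (n + k) w) := by
  have : 2 * n / 2 = n := by omega
  rw [gradedEval, this]

theorem gradedEval_comp {s : Bool} {m j n : ℕ} {u v R : List (Slice P.V)}
    (hR : IsDiagram s 0 R (2 * m))
    (hT : IsDiagram true 0 (u ++ Slice.box j (P.eval s m R) :: v) (2 * (n + k))) :
    P.gradedEval k (u ++ Slice.box j (P.eval s m R) :: v) (2 * n) =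
      P.gradedEval k (u ++ (shiftWord j R ++ v)) (2 * n) := by
  rw [gradedEval_two_mul, gradedEval_two_mul, eval_comp hR hT]

theorem isDiagram_box_append {s : Bool} {i N : ℕ} (x : P.V s (i + k))
    {c : List (Slice P.V) × ℕ} (hc : c ∈ capWords P.V 0 (2 * i)) (hN : c.2 = 2 * N) :
    IsDiagram s 0 (Slice.box 0 x :: c.1) (2 * (N + k)) := by
  refine ⟨le_rfl, by simp, ?_⟩
  have := isDiagram_shiftWord_capWords hc s 0 (2 * k)
  rw [shiftWord_zero, hN] at this
  convert this using 1 <;> ring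

theorem exists_two_mul_of_mem_capWords {V : Bool → ℕ → Type u} {i : ℕ}
    {c : List (Slice V) × ℕ} (hc : c ∈ capWords V 0 (2 * i)) : ∃ p, c.2 = 2 * p :=
  ⟨c.2 / 2, by have := parity_capWords hc; omega⟩

/-- The box that is labelled by the value of `T` is replaced by `T` itself, so that maxima can
interact with the strings of `T`. -/
theorem X_single_Z (i : ℕ) (T : Tangle P.V true (i + k)) :
    P.X k (DFinsupp.single i (P.Z T)) = ((capWords P.V 0 (2 * i)).map fun c =>
      P.gradedEval k (T.word ++ c.1) c.2).sum := by
  rw [X_single]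
  refine congrArg Multiset.sum (Multiset.map_congr rfl fun c hc => ?_)
  obtain ⟨p, hp⟩ := exists_two_mul_of_mem_capWords hc
  have h1 := P.gradedEval_comp k (u := []) (v := c.1) (j := 0) (n := p) T.valid
    (P.isDiagram_box_append k _ hc hp)
  simp only [shiftWord_zero, List.nil_append] at h1
  rw [eval_eq_Z, hp, h1]

/-! ### The products -/

theorem Z_mul_add_left {m n : ℕ} (i : ℕ) (hi : i ≤ min (2 * m) (2 * n))
    (x x' : P.V true (m + k)) (y : P.V true (n + k)) :
    P.Z (Tangle.mul k i hi (x + x') y) =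
      P.Z (Tangle.mul k i hi x y) + P.Z (Tangle.mul k i hi x' y) :=
  P.Z_add [] _ 0 x x' _ _ _ rfl rfl rfl

theorem Z_mul_add_right {m n : ℕ} (i : ℕ) (hi : i ≤ min (2 * m) (2 * n))
    (x : P.V true (m + k)) (y y' : P.V true (n + k)) :
    P.Z (Tangle.mul k i hi x (y + y')) =
      P.Z (Tangle.mul k i hi x y) + P.Z (Tangle.mul k i hi x y') :=
  P.Z_add ([Slice.box 0 x] ++ nestedCups (2 * m + k) k) (nestedCaps (2 * m + 3 * k + 2 * n) k ++
      (nestedCaps (2 * m) k ++ nestedCaps (2 * m - i) i)) (2 * m + 2 * k) y y' _ _ _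
    (by simp [Tangle.mul]) (by simp [Tangle.mul]) (by simp [Tangle.mul])

/-- The juxtaposition product as a biadditive map. -/
noncomputable def bulletHom : P.Gr k →+ P.Gr k →+ P.Gr k :=
  biadditiveSum (fun m n x y => DFinsupp.single (m + n - 0)
      (P.Z (Tangle.mul k 0 (Nat.zero_le _) x y)))
    (fun m n x x' y => by rw [Z_mul_add_left, DFinsupp.single_add])
    (fun m n x y y' => by rw [Z_mul_add_right, DFinsupp.single_add])

theorem bullet_eq (a b : P.Gr k) : P.bullet k a b = P.bulletHom k a b := rfl

/-- The product `a ⋆ b` as a biadditive map. -/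
noncomputable def starMulHom : P.Gr k →+ P.Gr k →+ P.Gr k :=
  biadditiveSum (fun m n x y => ∑ i : Fin (min (2 * m) (2 * n) + 1),
      DFinsupp.single (m + n - (i : ℕ))
        (P.Z (Tangle.mul k (i : ℕ) (Nat.lt_succ_iff.mp i.isLt) x y)))
    (fun m n x x' y => by
      simp only [Z_mul_add_left, DFinsupp.single_add, Finset.sum_add_distrib])
    (fun m n x y y' => by
      simp only [Z_mul_add_right, DFinsupp.single_add, Finset.sum_add_distrib])

theorem starMul_eq (a b : P.Gr k) : P.starMul k a b = P.starMulHom k a b := rfl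

theorem gradedEval_mul {m n i : ℕ} (hi : i ≤ min (2 * m) (2 * n)) {U W : List (Slice P.V)}
    (hU : IsDiagram true 0 U (2 * (m + k))) (hW : IsDiagram true 0 W (2 * (n + k))) :
    P.gradedEval k (Tangle.mul k i hi (P.eval true (m + k) U) (P.eval true (n + k) W)).word
        (2 * m + 2 * n - 2 * i) =
      P.gradedEval k (U ++ (nestedCups (2 * m + k) k ++ (shiftWord (2 * m + 2 * k) W ++
        (nestedCaps (2 * m + 3 * k + 2 * n) k ++ (nestedCaps (2 * m) k ++
          nestedCaps (2 * m - i) i))))) (2 * m + 2 * n - 2 * i) := by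
  have h0 : 2 * m + 2 * n - 2 * i = 2 * (m + n - i) := by omega
  rw [h0]
  have hword : (Tangle.mul k i hi (P.eval true (m + k) U) (P.eval true (n + k) W)).word =
      [] ++ Slice.box 0 (P.eval true (m + k) U) :: (nestedCups (2 * m + k) k ++
        (Slice.box (2 * m + 2 * k) (P.eval true (n + k) W) :: (nestedCaps (2 * m + 3 * k + 2 * n) k ++
          (nestedCaps (2 * m) k ++ nestedCaps (2 * m - i) i)))) := by
    simp only [Tangle.mul, List.append_assoc, List.cons_append, List.nil_append]
  have hv := (Tangle.mul k i hi (P.eval true (m + k) U) (P.eval true (n + k) W)).valid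
  rw [hword] at hv ⊢
  have hv' := isDiagram_comp hU _ hv
  rw [P.gradedEval_comp k hU hv]
  rw [shiftWord_zero, List.nil_append, ← List.append_assoc] at hv' ⊢
  rw [P.gradedEval_comp k hW hv', List.append_assoc]

/-- Both boxes of the multiplication tangle are opened by composition. The even numbers `p` and `q`
are kept as variables, to be the numbers of strings that two words of maxima leave. -/
theorem starMulHom_gradedEval {p q m n : ℕ} (hp : p = 2 * m) (hq : q = 2 * n)
    {U W : List (Slice P.V)}
    (hU : IsDiagram true 0 U (2 * (m + k))) (hW : IsDiagram true 0 W (2 * (n + k))) :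
    P.starMulHom k (P.gradedEval k U p) (P.gradedEval k W q) =
      ∑ i ∈ Finset.range (min p q + 1),
        P.gradedEval k (U ++ (nestedCups (p + k) k ++ (shiftWord (p + 2 * k) W ++
          (nestedCaps (p + 3 * k + q) k ++ (nestedCaps p k ++ nestedCaps (p - i) i)))))
            (p + q - 2 * i) := by
  subst hp hq
  rw [gradedEval_two_mul, gradedEval_two_mul, starMulHom, biadditiveSum_single,
    ← Fin.sum_univ_eq_sum_range fun i =>
      P.gradedEval k (U ++ (nestedCups (2 * m + k) k ++ (shiftWord (2 * m + 2 * k) W ++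
          (nestedCaps (2 * m + 3 * k + 2 * n) k ++ (nestedCaps (2 * m) k ++
            nestedCaps (2 * m - i) i))))) (2 * m + 2 * n - 2 * i)]
  refine Finset.sum_congr rfl fun i _ => ?_
  rw [← P.gradedEval_mul k (Nat.lt_succ_iff.mp i.isLt) hU hW]
  have := i.isLt
  exact P.single_Z k _ rfl (by omega)

/-- Both sides are sums over a word `c` on the top of `x`, a word `d` on the top of `y`, and a
number `i` of nested maxima between the remaining strings; corresponding diagrams differ only by
exchanges of heights. -/
theorem X_bullet_single (m n : ℕ) (x : P.V true (m + k)) (y : P.V true (n + k)) :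
    P.X k (P.bulletHom k (DFinsupp.single m x) (DFinsupp.single n y)) =
      P.starMulHom k (P.X k (DFinsupp.single m x)) (P.X k (DFinsupp.single n y)) := by
  rw [bulletHom, biadditiveSum_single]
  refine (P.X_single_Z k (m + n) _).trans ?_
  rw [X_single, X_single, mul_add, sum_capWords_add, ← AddMonoidHom.flip_apply (P.starMulHom k),
    map_multiset_sum ((P.starMulHom k).flip _), Multiset.map_map]
  refine congrArg Multiset.sum (Multiset.map_congr rfl fun c hc => ?_)
  obtain ⟨p, hp⟩ := exists_two_mul_of_mem_capWords hc
  simp only [Function.comp_apply, AddMonoidHom.flip_apply]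
  rw [map_multiset_sum, Multiset.map_map]
  refine (sum_capWords_split (fun w t => P.gradedEval k
    ((Tangle.mul k 0 (Nat.zero_le _) x y).word ++ (c.1 ++ w)) t)
    (fun w w' t h => P.gradedEval_exch k ((h.append_left _).append_left _) t) c.2 (2 * n)).trans ?_
  refine congrArg Multiset.sum (Multiset.map_congr rfl fun d hd => ?_)
  obtain ⟨q, hq⟩ := exists_two_mul_of_mem_capWords hd
  simp only [Function.comp_apply]
  rw [P.starMulHom_gradedEval k hp hq (P.isDiagram_box_append k x hc hp)
    (P.isDiagram_box_append k y hd hq)]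
  refine Finset.sum_congr rfl fun i hi => P.gradedEval_exch k ?_ _
  -- the maxima of `x` move below `y`
  have hcd := isDiagram_capWords hc true
  rw [zero_add] at hcd
  have e1 := ((Exch.interchange hcd (nestedCups k k ++ (Slice.box (2 * k) y ::
    (nestedCaps (3 * k + 2 * n) k ++ nestedCaps 0 k)))).symm.append_left
      [Slice.box 0 x]).append_right (shiftWord c.2 d.1 ++ nestedCaps (c.2 - i) i)
  -- the maxima of `y` move below the strings on the sides
  have e2 : Exch (nestedCaps (3 * k + 2 * n) k ++ (nestedCaps 0 k ++ d.1))
      (shiftWord (2 * k) d.1 ++ (nestedCaps (3 * k + d.2) k ++ nestedCaps 0 k)) := by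
    have h1 := Exch.nestedCaps_comm 0 k d.1
    simp only [shiftWord_zero, zero_add] at h1
    have h2 := isDiagram_shiftWord_capWords hd true (2 * k) 0
    have h3 := Exch.interchange h2 (nestedCaps k k)
    simp only [shiftWord_nestedCaps] at h3
    rw [show 2 * k + d.2 + 0 + k = 3 * k + d.2 by ring,
      show 2 * k + 2 * n + 0 + k = 3 * k + 2 * n by ring] at h3
    refine (h1.append_left _).trans ?_
    have h4 := (h3.append_right (nestedCaps 0 k)).symm
    simpa only [List.append_assoc] using h4
  have e3 := ((e2.shiftWord c.2).append_left ([Slice.box 0 x] ++ (c.1 ++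
    (nestedCups (c.2 + k) k ++ [Slice.box (c.2 + 2 * k) y])))).append_right
      (nestedCaps (c.2 - i) i)
  simp only [shiftWord_append, shiftWord_cons, shiftWord_nestedCaps, shiftWord_nestedCups, shiftWord_shiftWord, Slice.shift, add_zero, List.append_assoc,
    List.cons_append, List.nil_append, Tangle.mul, nestedCaps, ← add_assoc] at e1 e3 ⊢
  exact e1.trans e3

theorem X_bullet (a b : P.Gr k) :
    P.X k (P.bullet k a b) = P.starMul k (P.X k a) (P.X k b) := by
  rw [bullet_eq, starMul_eq]
  refine eq_of_eq_on_single (f := fun a => P.X k (P.bulletHom k a b))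
    (g := fun a => P.starMulHom k (P.X k a) (P.X k b)) (fun a a' => by simp) (fun a a' => by simp)
    (fun m x => ?_) a
  refine eq_of_eq_on_single (f := fun b => P.X k (P.bulletHom k (DFinsupp.single m x) b))
    (g := fun b => P.starMulHom k (P.X k (DFinsupp.single m x)) (P.X k b)) (fun a a' => by simp)
    (fun a a' => by simp) (fun n y => ?_) b
  exact P.X_bullet_single k m n x y

/-! ### The involution -/

/-- The involution on a homogeneous element. -/
noncomputable def daggerTerm (n : ℕ) (x : P.V true (n + k)) : P.Gr k :=
  DFinsupp.single n (P.Z (Tangle.rotate n k (P.adj x)))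

open Classical in
/-- The involution as an additive map. -/
noncomputable def daggerHom : P.Gr k →+ P.Gr k :=
  AddMonoidHom.mk' (fun a => P.dagger k a) fun a b => by
    have h : ∀ n (x y : P.V true (n + k)), P.daggerTerm k n (x + y) =
        P.daggerTerm k n x + P.daggerTerm k n y := by
      intro n x y
      rw [daggerTerm, daggerTerm, daggerTerm, P.adj_add, ← DFinsupp.single_add]
      congr 1
      exact P.Z_add (nestedCups 0 (2 * n)) (nestedCaps (2 * n + 2 * k) (2 * n)) (2 * n)
        (P.adj x) (P.adj y) _ _ _ (by simp [Tangle.rotate]) (by simp [Tangle.rotate]) (by simp [Tangle.rotate])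
    exact DFinsupp.sum_add_index (h := P.daggerTerm k) (fun n => by simpa using h n 0 0) h

theorem dagger_single (n : ℕ) (x : P.V true (n + k)) :
    P.daggerHom k (DFinsupp.single n x) = P.daggerTerm k n x := by
  classical
  have h : P.daggerTerm k n 0 = 0 := by
    have := P.Z_smul (s := true) (nestedCups 0 (2 * n)) (nestedCaps (2 * n + 2 * k) (2 * n))
      (2 * n) 0 (0 : P.V true (n + k)) (Tangle.rotate n k 0) (Tangle.rotate n k 0)
      (by simp [Tangle.rotate]) (by simp [Tangle.rotate])
    rw [daggerTerm, adj_zero, this, zero_smul, DFinsupp.single_zero]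
  exact DFinsupp.sum_single_index (h := P.daggerTerm k) h

theorem dagger_gradedEval {t n : ℕ} (ht : t = 2 * n) {W : List (Slice P.V)}
    (hW : IsDiagram true 0 W (2 * (n + k))) :
    P.daggerHom k (P.gradedEval k W t) = P.gradedEval k (nestedCups 0 t ++
      (shiftWord t (reflectWord P.adj 0 W) ++ nestedCaps (t + 2 * k) t)) t := by
  subst ht
  rw [gradedEval_two_mul, dagger_single, daggerTerm, ← eval_reflectWord hW]
  have hW' := isDiagram_reflectWord P.adj hW
  rw [Nat.bodd_zero, Bool.xor_false] at hW'
  have hv := (Tangle.rotate n k (P.eval true (n + k) (reflectWord P.adj 0 W))).valid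
  rw [P.single_Z k _ rfl rfl]
  simp only [Tangle.rotate, List.append_assoc, List.cons_append, List.nil_append] at hv ⊢
  exact P.gradedEval_comp k hW' hv

/-- On the left the word sits above the rotation and is slid through it to the last `2 * i` points
of the adjoint box. On the right the word is reflected together with its box and arrives at the same
points as its mirror image. The two sums agree because reflection permutes the words up to exchange.
-/
theorem X_dagger (a : P.Gr k) : P.X k (P.dagger k a) = P.dagger k (P.X k a) := by
  refine eq_of_eq_on_single (f := fun a => P.X k (P.daggerHom k a))
    (g := fun a => P.daggerHom k (P.X k a)) (fun a a' => by simp) (fun a a' => by simp)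
    (fun i x => ?_) a
  rw [dagger_single, daggerTerm, X_single_Z, X_single, map_multiset_sum, Multiset.map_map]
  let F : List (Slice P.V) → ℕ → P.Gr k := fun w t => P.gradedEval k (nestedCups 0 t ++
    (shiftWord t (Slice.box 0 (P.adj x) :: shiftWord (2 * k) w) ++ nestedCaps (t + 2 * k) t)) t
  have hF := sum_capWords_reflect P.adj F (fun w w' t h => P.gradedEval_exch k
    (((((h.shiftWord (2 * k)).append_left [Slice.box 0 (P.adj x)]).shiftWord t).append_right
      _).append_left _) t) (2 * i)
  refine Eq.trans ?_ (hF.symm.trans ?_)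
  · refine congrArg Multiset.sum (Multiset.map_congr rfl fun c hc => ?_)
    have hcd := isDiagram_capWords hc true
    rw [zero_add] at hcd
    simp only [F, gradedEval]
    congr 1
    have := eval_rotate_capWord (s := true) (K := c.2 / 2 + k) (c := 2 * k) hcd
      (eq_cap_of_mem_capWords hc) (Y := [Slice.box 0 (P.adj x)])
      ⟨le_rfl, by simp, by simp only [IsDiagram]; omega⟩ (by simp)
    simpa [Tangle.rotate, Slice.shift] using this
  · refine congrArg Multiset.sum (Multiset.map_congr rfl fun c hc => ?_)
    obtain ⟨p, hp⟩ := exists_two_mul_of_mem_capWords hc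
    have hcd := isDiagram_capWords hc true
    rw [zero_add] at hcd
    rw [Function.comp_apply, P.dagger_gradedEval k hp (P.isDiagram_box_append k x hc hp)]
    simp only [F, reflectWord]
    rw [show 0 + 2 * (i + k) = 2 * k + 2 * i by ring, reflectWord_add P.adj hcd]

/-! ### The inner products -/

/-- The normalized value of a closed word. -/
noncomputable def closedValue (w : List (Slice P.V)) : ℂ :=
  ((P.δ : ℂ) ^ k)⁻¹ * P.scalar (P.eval true 0 w)

theorem closedValue_exch {w w' : List (Slice P.V)} (h : Exch w w') :
    P.closedValue k w = P.closedValue k w' := by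
  rw [closedValue, closedValue, eval_exch h]

theorem scalar_add {s : Bool} (x y : P.V s 0) :
    P.scalar (x + y) = P.scalar x + P.scalar y := (P.scalarHom s).map_add x y

theorem closedValue_add {t : Bool} {m j : ℕ} (u v : List (Slice P.V)) (x y : P.V t m) :
    P.closedValue k (u ++ Slice.box j (x + y) :: v) =
      P.closedValue k (u ++ Slice.box j x :: v) + P.closedValue k (u ++ Slice.box j y :: v) := by
  rw [closedValue, eval_add, scalar_add, mul_add]; rfl

theorem closedValue_Z {w : List (Slice P.V)} (T : Tangle P.V true 0) (h : T.word = w) :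
    ((P.δ : ℂ) ^ k)⁻¹ * P.scalar (P.Z T) = P.closedValue k w := by
  rw [eval_eq_Z, h]; rfl

theorem closedValue_pair {n : ℕ} (x y : P.V true n) :
    ((P.δ : ℂ) ^ k)⁻¹ * P.scalar (P.Z (Tangle.pair x y)) =
      P.closedValue k (Slice.box 0 x :: Slice.box (2 * n) y :: nestedCaps 0 (2 * n)) :=
  P.closedValue_Z k _ rfl

open Classical in
/-- The inner product `⟨a, b⟩` as a biadditive map. -/
noncomputable def innerHom : P.Gr k →+ P.Gr k →+ ℂ :=
  have hl : ∀ n (x x' y : P.V true (n + k)),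
      ((P.δ : ℂ) ^ k)⁻¹ * P.scalar (P.Z (Tangle.pair (x + x') y)) =
      ((P.δ : ℂ) ^ k)⁻¹ * P.scalar (P.Z (Tangle.pair x y)) +
        ((P.δ : ℂ) ^ k)⁻¹ * P.scalar (P.Z (Tangle.pair x' y)) := fun n x x' y => by
    simp only [closedValue_pair]
    exact P.closedValue_add k [] _ x x'
  have hr : ∀ n (x y y' : P.V true (n + k)),
      ((P.δ : ℂ) ^ k)⁻¹ * P.scalar (P.Z (Tangle.pair x (y + y'))) =
      ((P.δ : ℂ) ^ k)⁻¹ * P.scalar (P.Z (Tangle.pair x y)) +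
        ((P.δ : ℂ) ^ k)⁻¹ * P.scalar (P.Z (Tangle.pair x y')) := fun n x y y' => by
    simp only [closedValue_pair]
    exact P.closedValue_add k [_] _ y y'
  AddMonoidHom.mk' (fun a => AddMonoidHom.mk' (fun b => P.inner k a b) (fun b b' => by
      simp only [inner, ← DFinsupp.sum_add]
      congr 1
      funext n x
      rw [DFinsupp.add_apply, P.adj_add, hr]))
    fun a a' => by
      refine AddMonoidHom.ext fun b => ?_
      exact DFinsupp.sum_add_index
        (h := fun n (x : P.V true (n + k)) =>
          ((P.δ : ℂ) ^ k)⁻¹ * P.scalar (P.Z (Tangle.pair x (P.adj (b n)))))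
        (fun n => by simpa using hl n 0 0 (P.adj (b n))) fun n x x' => hl n x x' _

theorem inner_eq (a b : P.Gr k) : P.inner k a b = P.innerHom k a b := rfl

end SubfactorPlanarAlgebra

/-! ### Comparison of the two inner products -/

namespace SubfactorPlanarAlgebra

open PlanarStarAlgebra

variable (P : SubfactorPlanarAlgebra.{u}) (k : ℕ)

theorem innerHom_single (m n : ℕ) (x : P.V true (m + k)) (y : P.V true (n + k)) :
    P.innerHom k (DFinsupp.single m x) (DFinsupp.single n y) =
      if h : n = m then P.closedValue k (Slice.box 0 x :: Slice.box (2 * (m + k))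
        (P.adj (h ▸ y : P.V true (m + k))) :: nestedCaps 0 (2 * (m + k))) else 0 := by
  classical
  have h0 : ∀ u v : List (Slice P.V), ∀ j, P.closedValue k
      (u ++ Slice.box j (0 : P.V true (m + k)) :: v) = 0 := fun u v j => by
    simpa using P.closedValue_add k (j := j) u v (0 : P.V true (m + k)) 0
  have h1 : P.innerHom k (DFinsupp.single m x) (DFinsupp.single n y) =
      ((P.δ : ℂ) ^ k)⁻¹ * P.scalar (P.Z (Tangle.pair x
        (P.adj ((DFinsupp.single n y : P.Gr k) m)))) := by
    refine DFinsupp.sum_single_index (h := fun i (z : P.V true (i + k)) => ((P.δ : ℂ) ^ k)⁻¹ *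
      P.scalar (P.Z (Tangle.pair z (P.adj ((DFinsupp.single n y : P.Gr k) i))))) ?_
    rw [closedValue_pair]
    exact h0 [] _ 0
  rw [h1, closedValue_pair, DFinsupp.single_apply]
  split_ifs with h
  · rfl
  · rw [adj_zero]
    exact h0 [_] _ _

theorem innerHom_gradedEval {p q m n : ℕ} (hp : p = 2 * m) (hq : q = 2 * n)
    {U W : List (Slice P.V)}
    (hU : IsDiagram true 0 U (2 * (m + k))) (hW : IsDiagram true 0 W (2 * (n + k))) :
    P.innerHom k (P.gradedEval k U p) (P.gradedEval k W q) =
      if q = p then P.closedValue k (U ++ (shiftWord (p + 2 * k) (reflectWord P.adj 0 W) ++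
        nestedCaps 0 (p + 2 * k))) else 0 := by
  subst hp hq
  rw [gradedEval_two_mul, gradedEval_two_mul, innerHom_single]
  by_cases h : n = m
  · subst h
    rw [dif_pos rfl, if_pos rfl, ← eval_reflectWord hW]
    have hW' := isDiagram_reflectWord P.adj hW
    rw [Nat.bodd_zero, Bool.xor_false] at hW'
    have hv : IsDiagram true 0 ([] ++ Slice.box 0 (P.eval true (n + k) U) ::
        (Slice.box (2 * (n + k)) (P.eval true (n + k) (reflectWord P.adj 0 W)) ::
          nestedCaps 0 (2 * (n + k)))) (2 * 0) := (Tangle.pair _ _).valid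
    have hv' := isDiagram_comp hU _ hv
    have h1 := eval_comp hU hv
    rw [shiftWord_zero, List.nil_append] at hv' h1
    have h2 := eval_comp hW' hv'
    rw [← mul_add]
    unfold closedValue
    rw [← h2]
    exact congrArg _ (congrArg _ h1)
  · rw [dif_neg h, if_neg (by omega)]

theorem Z_pairTL_add_left {m n : ℕ} (D : TLDiagram (2 * (m + n)) 0)
    (x x' : P.V true (m + k)) (z : P.V true (n + k)) :
    P.Z (Tangle.pairTL k D (x + x') z) =
      P.Z (Tangle.pairTL k D x z) + P.Z (Tangle.pairTL k D x' z) :=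
  P.Z_add [] _ 0 x x' _ _ _ rfl rfl rfl

theorem Z_pairTL_add_right {m n : ℕ} (D : TLDiagram (2 * (m + n)) 0)
    (x : P.V true (m + k)) (z z' : P.V true (n + k)) :
    P.Z (Tangle.pairTL k D x (z + z')) =
      P.Z (Tangle.pairTL k D x z) + P.Z (Tangle.pairTL k D x z') :=
  P.Z_add [Slice.box 0 x] (nestedCaps (2 * m) (2 * k) ++ D.word) (2 * (m + k)) z z' _ _ _
    (by simp [Tangle.pairTL]) (by simp [Tangle.pairTL]) (by simp [Tangle.pairTL])

/-- The inner product `⟨⟨a, b⟩⟩` as a biadditive map. -/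
noncomputable def gjsInnerHom : P.Gr k →+ P.Gr k →+ ℂ :=
  biadditiveSum (fun m n x y => ∑ D : TLDiagram (2 * (m + n)) 0,
      ((P.δ : ℂ) ^ k)⁻¹ * P.scalar (P.Z (Tangle.pairTL k D x (P.adj y))))
    (fun m n x x' y => by
      simp only [Z_pairTL_add_left, scalar_add, mul_add, Finset.sum_add_distrib])
    (fun m n x y y' => by
      simp only [P.adj_add, Z_pairTL_add_right, scalar_add, mul_add, Finset.sum_add_distrib])

theorem gjsInner_eq (a b : P.Gr k) : P.gjsInner k a b = P.gjsInnerHom k a b := rfl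

/-- A diagram without top points is vacuously epi, so the enumeration of epi diagrams applies with
no string remaining. -/
theorem gjsInnerHom_single (m n : ℕ) (x : P.V true (m + k)) (y : P.V true (n + k)) :
    P.gjsInnerHom k (DFinsupp.single m x) (DFinsupp.single n y) =
      ((capWords P.V 0 (2 * (m + n))).map fun c => if c.2 = 0 then
        P.closedValue k (Slice.box 0 x :: Slice.box (2 * (m + k)) (P.adj y) ::
          (nestedCaps (2 * m) (2 * k) ++ c.1)) else 0).sum := by
  classical
  rw [gjsInnerHom, biadditiveSum_single, ← sum_epi_eq_sum_capWords (2 * (m + n)) 0 fun w =>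
    P.closedValue k (Slice.box 0 x :: Slice.box (2 * (m + k)) (P.adj y) ::
          (nestedCaps (2 * m) (2 * k) ++ w))]
  rw [← (Equiv.subtypeUnivEquiv (p := fun D : TLDiagram (2 * (m + n)) 0 => D.IsEpi)
    fun D j => j.elim0).sum_comp]
  refine Finset.sum_congr (by congr) fun D _ => P.closedValue_Z k _ ?_
  simp [Tangle.pairTL, Equiv.subtypeUnivEquiv]

/-- A closing diagram splits into a word `c` on `x`, a word `d` on the mirror image of `y`, and `i`
nested maxima. That nothing remains means `i = c.2 = d.2`, which is also the orthogonality of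
different degrees in the pairing of `Gr`. -/
theorem gjsInnerHom_single_eq (m n : ℕ) (x : P.V true (m + k)) (y : P.V true (n + k)) :
    P.gjsInnerHom k (DFinsupp.single m x) (DFinsupp.single n y) =
      P.innerHom k (P.X k (DFinsupp.single m x)) (P.X k (DFinsupp.single n y)) := by
  rw [gjsInnerHom_single, X_single, X_single, mul_add 2 m n, sum_capWords_add,
    ← AddMonoidHom.flip_apply (P.innerHom k), map_multiset_sum ((P.innerHom k).flip _),
    Multiset.map_map]
  refine congrArg Multiset.sum (Multiset.map_congr rfl fun c hc => ?_)
  obtain ⟨p, hp⟩ := exists_two_mul_of_mem_capWords hc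
  simp only [Function.comp_apply, AddMonoidHom.flip_apply]
  rw [map_multiset_sum, Multiset.map_map]
  refine (sum_capWords_split (fun w t => if t = 0 then P.closedValue k (Slice.box 0 x ::
    Slice.box (2 * (m + k)) (P.adj y) :: (nestedCaps (2 * m) (2 * k) ++ (c.1 ++ w))) else 0)
    (fun w w' t h => if_congr Iff.rfl (P.closedValue_exch k (((h.append_left c.1).append_left
      (nestedCaps (2 * m) (2 * k))).append_left [Slice.box 0 x, Slice.box (2 * (m + k)) (P.adj y)]))
      rfl)
    c.2 (2 * n)).trans ?_
  -- the maxima of `y` are reflected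
  let F : List (Slice P.V) → ℕ → ℂ := fun w t => if t = c.2 then P.closedValue k
    (Slice.box 0 x :: (c.1 ++ (Slice.box (c.2 + 2 * k) (P.adj y) ::
      (shiftWord (c.2 + 2 * k + 2 * k) w ++ nestedCaps 0 (c.2 + 2 * k))))) else 0
  have hF := sum_capWords_reflect P.adj F (fun w w' t h => if_congr Iff.rfl
    (P.closedValue_exch k (((((h.shiftWord (c.2 + 2 * k + 2 * k)).append_right
      (nestedCaps 0 (c.2 + 2 * k))).append_left
        [Slice.box (c.2 + 2 * k) (P.adj y)]).append_left c.1).append_left [Slice.box 0 x])) rfl)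
    (2 * n)
  refine Eq.trans ?_ (hF.symm.trans ?_)
  · refine congrArg Multiset.sum (Multiset.map_congr rfl fun d hd => ?_)
    simp only [F]
    split_ifs with h
    · rw [Finset.sum_eq_single c.2]
      · rw [if_pos (by omega)]
        refine P.closedValue_exch k ?_
        have hcd := isDiagram_capWords hc true
        rw [zero_add] at hcd
        have e1 := ((Exch.interchange hcd (Slice.box (2 * k) (P.adj y) ::
          nestedCaps 0 (2 * k))).symm.append_left [Slice.box 0 x]).append_right
            (shiftWord c.2 d.1 ++ nestedCaps 0 c.2)
        have e2 := ((Exch.nestedCaps_comm c.2 (2 * k) d.1).append_left ([Slice.box 0 x] ++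
          (c.1 ++ [Slice.box (c.2 + 2 * k) (P.adj y)]))).append_right (nestedCaps 0 c.2)
        -- The `2 * k` maxima on the sides and the `c.2` maxima on the top form the single nest by
        -- which the pairing joins two boxes.
        rw [nestedCaps_add 0 c.2 (2 * k), zero_add, Nat.sub_self,
          show c.2 + 2 * k + 2 * k = c.2 + 2 * (2 * k) by ring, mul_add]
        simp only [shiftWord_cons, shiftWord_nestedCaps, Slice.shift, add_zero, List.append_assoc,
          List.cons_append, List.nil_append] at e1 e2 ⊢
        exact e1.trans e2
      · intro i hi hne
        rw [Finset.mem_range] at hi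
        rw [if_neg (by omega)]
      · intro hn
        rw [Finset.mem_range] at hn
        omega
    · refine Finset.sum_eq_zero fun i hi => ?_
      rw [Finset.mem_range] at hi
      rw [if_neg (by omega)]
  · refine congrArg Multiset.sum (Multiset.map_congr rfl fun d hd => ?_)
    obtain ⟨q, hq⟩ := exists_two_mul_of_mem_capWords hd
    have hdd := isDiagram_capWords hd true
    rw [zero_add] at hdd
    rw [Function.comp_apply, P.innerHom_gradedEval k hp hq (P.isDiagram_box_append k x hc hp)
      (P.isDiagram_box_append k y hd hq)]
    simp only [F, reflectWord]
    rw [show 0 + 2 * (n + k) = 2 * k + 2 * n by ring, reflectWord_add P.adj hdd]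
    simp [shiftWord_shiftWord, Slice.shift]

theorem gjsInner_eq_inner_X (a b : P.Gr k) :
    P.gjsInner k a b = P.inner k (P.X k a) (P.X k b) := by
  rw [gjsInner_eq, inner_eq]
  refine eq_of_eq_on_single (f := fun a => P.gjsInnerHom k a b)
    (g := fun a => P.innerHom k (P.X k a) (P.X k b)) (fun a a' => by simp) (fun a a' => by simp)
    (fun m x => ?_) a
  refine eq_of_eq_on_single (f := fun b => P.gjsInnerHom k (DFinsupp.single m x) b)
    (g := fun b => P.innerHom k (P.X k (DFinsupp.single m x)) (P.X k b)) (fun a a' => by simp)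
    (fun a a' => by simp) (fun n y => ?_) b
  exact P.gjsInnerHom_single_eq k m n x y

end SubfactorPlanarAlgebra

theorem mainTheorem11 (P : SubfactorPlanarAlgebra.{u}) (k : ℕ) :
    (∀ a b : P.Gr k, P.gjsInner k a b = P.inner k (P.X k a) (P.X k b)) ∧
    Function.Bijective (P.X k) ∧
    P.X k (P.one k) = P.one k ∧
    (∀ a b : P.Gr k, P.X k (P.bullet k a b) = P.starMul k (P.X k a) (P.X k b)) ∧
    (∀ a : P.Gr k, P.X k (P.dagger k a) = P.dagger k (P.X k a)) :=
  ⟨P.gjsInner_eq_inner_X k, P.X_bijective k, P.X_one k, P.X_bullet k, P.X_dagger k⟩
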